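/- A grid path of length $n$ is a word $v\in\{N,E\}^n$, viewed as a walk starting at $(0,0)$ with unit north steps $N=(0,1)$ and unit east steps $E=(1,0)$. For a grid path $v$, let $\mathrm{Tam}(v)$ be the set of grid paths that have the same endpoints as $v$ and are weakly above $v$. For a grid point $p$ on a path of $\mathrm{Tam}(v)$, let $\mathrm{horiz}_v(p)$ be the maximum number of east steps that can be taken starting from $p$ without crossing $v$; equivalently, it is $x_{\max}-x(p)$, where $x_{\max}$ is the largest abscissa of a point of $v$ at the height of $p$. For $v_1\in\mathrm{Tam}(v)$ and a point $p$ of $v_1$ preceded by a step $E$ and followed by a step $N$ in $v_1$, let $p'$ be the first grid point of $v_1$ after $p$ with $\mathrm{horiz}_v(p')=\mathrm{horiz}_v(p)$, and let $v_1'$ be the path obtained from $v_1$ by exchanging the step $E$ just before $p$ with the sub-path of $v_1$ from $p$ to $p'$; write $v_1\prec_v v_1'$. Let $\le_v$ be the reflexive transitive closure of $\prec_v$ on $\mathrm{Tam}(v)$, and let $\mathrm{Int}(\mathrm{Tam}(v))$ be the number of intervals of $\mathrm{Tam}(v)$, that is, of pairs $(v_1,v_2)$ of elements of $\mathrm{Tam}(v)$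 with $v_1\le_v v_2$. Then for every integer $n\ge 0$, $$\sum_{v\in\{N,E\}^n}\mathrm{Int}(\mathrm{Tam}(v))=\frac{2\,(3n+3)!}{(n+2)!\,(2n+3)!}.$$ -/

import Mathlib

/-- The two unit steps of a grid path: north `N = (0,1)` and east `E = (1,0)`. -/
inductive GridStep where
  | N
  | E
  deriving DecidableEq

instance : Fintype GridStep where
  elems := {GridStep.N, GridStep.E}
  complete x := by cases x <;> simp

/-- A grid path starting at `(0,0)`, given by its word of steps. Its size is its length. -/
abbrev GridPath := List GridStep

namespace GridPath

/-- The endpoint `(x, y)` of a grid path. The grid points on `w` are the endpoints of the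
prefixes of `w`. -/
def endpoint (w : GridPath) : ℕ × ℕ :=
  (w.count GridStep.E, w.count GridStep.N)

/-- `w` is weakly above `v` (used for paths with the same endpoints): after any number `i` of
steps, that is, on every antidiagonal `x + y = i`, the point of `w` is at least as high as the
point of `v`. -/
def WeaklyAbove (w v : GridPath) : Prop :=
  ∀ i, (endpoint (v.take i)).2 ≤ (endpoint (w.take i)).2

/-- The largest abscissa of a grid point of `v` at height `y`. -/
def rowEnd (v : GridPath) (y : ℕ) : ℕ :=
  ((Finset.range (v.length + 1)).filter fun i => (endpoint (v.take i)).2 = y).sup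
    fun i => (endpoint (v.take i)).1

/-- The horizontal distance from `p` to `v`: the maximum number of east steps that can be taken
starting from `p` (a point weakly above `v`) without crossing `v`. These steps stay at the height
of `p`, and the last point before crossing `v` is the rightmost point of `v` at that height. -/
def horiz (v : GridPath) (p : ℕ × ℕ) : ℕ :=
  rowEnd v p.2 - p.1

/-- The covering relation: `w` is `a E b c` and `w'` is `a b E c`, where the point `p` at the end
of `a E` is followed by a north step, and the end `p'` of `a E b` is the first point of `w`
after `p` with the same horizontal distance to `v` as `p`. -/
def Rotates (v w w' : GridPath) : Prop :=
  ∃ a b c : GridPath,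
    w = a ++ [GridStep.E] ++ b ++ c ∧
    w' = a ++ b ++ [GridStep.E] ++ c ∧
    b.head? = some GridStep.N ∧
    horiz v (endpoint (a ++ [GridStep.E] ++ b)) = horiz v (endpoint (a ++ [GridStep.E])) ∧
    ∀ j, 0 < j → j < b.length →
      horiz v (endpoint (a ++ [GridStep.E] ++ b.take j)) ≠
        horiz v (endpoint (a ++ [GridStep.E]))

end GridPath

/-- The generalized Tamari lattice of `v`: the grid paths with the same endpoints as `v` that are
weakly above `v`. -/
def Tam (v : GridPath) : Type :=
  {w : GridPath // w.endpoint = v.endpoint ∧ w.WeaklyAbove v}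

/-- The order of `Tam v`: the reflexive transitive closure of the covering relation. -/
instance Tam.instPreorder (v : GridPath) : Preorder (Tam v) where
  le := Relation.ReflTransGen fun w w' : Tam v => GridPath.Rotates v w.1 w'.1
  le_refl _ := Relation.ReflTransGen.refl
  le_trans _ _ _ := Relation.ReflTransGen.trans

instance Tam.instFinite (v : GridPath) : Finite (Tam v) := by
  refine Set.Finite.subset (List.finite_length_eq GridStep v.length) ?_
  rintro w ⟨h, -⟩
  have key : ∀ l : List GridStep, l.length = l.count GridStep.E + l.count GridStep.N := by
    intro l
    induction l with
    | nil => rfl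
    | cons a l ih => cases a <;> simp [ih] <;> omega
  simp only [GridPath.endpoint, Prod.mk.injEq] at h
  simp [key w, key v, h]

/-!
The intervals of all `Tam v` with `v` of length `n` are encoded by pairs of integer lists, the pairs
are counted by a recursion with one catalytic parameter, and the recursion is solved explicitly.

*Structure of the order.* The elements of `Tam (N :: v)` are the words `N :: w` with `w` in `Tam v`,
with the same order. An element of `Tam (E :: v)` has a first contact with `E :: v`, reached by an
east step. Removing this step leaves an element `w` of `Tam v` together with one of the contacts of
`w` with `v`, and every such pair occurs once. A rotation of the big word either moves the special
step to the next contact of `w` or rotates `w`. Since rotations only destroy contacts, the order of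
`Tam (E :: v)` is the product order on the pairs (`GridPath.reflTransGen_insertEast_iff`).
Iterating, an element of `Tam v` becomes a list of `n + 1` integers recording the successive first
contacts. The lists that occur are the nested ones, `v` is determined by the positions of the zero
entries, and the order is the entrywise one (`GridPath.reflTransGen_decode_iff`). Hence the sum
to be computed is the number of pairs of nested lists of length `n + 1` with the same zeros, the first at
most the second entrywise (`sum_card_nonemptyInterval_tam`).

*Counting.* Such a pair is cut after the first block of its larger list. This gives, for the
generating function `F(x)` in which `t` marks the length and `x` the positive cuts of the smaller
list, the equation `F = 1 + x t F (1 + (F - F(1)) / (x - 1))` (`sub_one_mul_nestedPoly_succ`).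

*Solution.* Let `u = t (1 + u) ^ 3` and `m = u + x t m (1 + u + m)`. Then
`F = 1 + u - m + x m / (1 + u)` solves the equation with `F(1) = 1 + u - u ^ 2`, and the solution is
unique (`eval_one_of_catalytic_recurrence`). The series `u - u ^ 2` satisfies a linear differential
equation that is the hypergeometric recurrence of the announced numbers
(`coeff_sub_sq_of_eq_X_mul_one_add_pow_three`).
-/

/-! ### Distance of a path to `v` -/

namespace GridPath

/-- The abscissa of the last point of `v` at height `y`, computed along the word. Above the top
row of `v` it is the abscissa of the endpoint. -/
def rowAbscissa : GridPath → ℕ → ℕ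
  | [], _ => 0
  | GridStep.N :: _, 0 => 0
  | GridStep.N :: v, y + 1 => rowAbscissa v y
  | GridStep.E :: v, y => rowAbscissa v y + 1

/-- The signed horizontal distance from the endpoint of `p` to `v`; it is negative when the
endpoint of `p` lies to the right of `v`. -/
def slack (v p : GridPath) : ℤ :=
  rowAbscissa v (p.count GridStep.N) - p.count GridStep.E

/-- `w` has the same endpoint as `v` and none of its points lies to the right of `v`. -/
def IsOver (v w : GridPath) : Prop :=
  w.count GridStep.E = v.count GridStep.E ∧ w.count GridStep.N = v.count GridStep.N ∧
    ∀ i, 0 ≤ slack v (w.take i)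

/-- The covering relation expressed with signed distances: strictly between the two points at
equal distance from `v`, the distance is larger. -/
def Rotation (v w w' : GridPath) : Prop :=
  ∃ a b c : GridPath,
    w = a ++ [GridStep.E] ++ b ++ c ∧
    w' = a ++ b ++ [GridStep.E] ++ c ∧
    b.head? = some GridStep.N ∧
    slack v (a ++ [GridStep.E] ++ b) = slack v (a ++ [GridStep.E]) ∧
    ∀ j, 0 < j → j < b.length →
      slack v (a ++ [GridStep.E]) < slack v (a ++ [GridStep.E] ++ b.take j)

theorem rowAbscissa_le_succ (v : GridPath) (y : ℕ) : rowAbscissa v y ≤ rowAbscissa v (y + 1) := by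
  induction v generalizing y with
  | nil => simp [rowAbscissa]
  | cons s v ih =>
    cases s
    · cases y
      · simp [rowAbscissa]
      · simpa [rowAbscissa] using ih _
    · simpa [rowAbscissa] using ih _

theorem rowAbscissa_mono (v : GridPath) : Monotone (rowAbscissa v) :=
  monotone_nat_of_le_succ (rowAbscissa_le_succ v)

theorem rowAbscissa_count_N (v : GridPath) :
    rowAbscissa v (v.count GridStep.N) = v.count GridStep.E := by
  induction v with
  | nil => rfl
  | cons s v ih => cases s <;> simp [rowAbscissa, ih]

theorem count_take_le_rowAbscissa (v : GridPath) (i : ℕ) :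
    (v.take i).count GridStep.E ≤ rowAbscissa v ((v.take i).count GridStep.N) := by
  induction v generalizing i with
  | nil => simp
  | cons s v ih =>
    cases i with
    | zero => simp
    | succ i => cases s <;> simpa [rowAbscissa] using ih i

theorem rowAbscissa_le_count_take (v : GridPath) (i y : ℕ)
    (h : y < (v.take i).count GridStep.N) :
    rowAbscissa v y ≤ (v.take i).count GridStep.E := by
  induction v generalizing i y with
  | nil => simp at h
  | cons s v ih =>
    cases i with
    | zero => simp at h
    | succ i =>
      cases s
      · cases y with
        | zero => simp [rowAbscissa]
        | succ y => simpa [rowAbscissa] using ih i y (by simpa using h)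
      · simpa [rowAbscissa] using ih i y (by simpa using h)

theorem exists_count_take_eq_rowAbscissa (v : GridPath) (y : ℕ) (h : y ≤ v.count GridStep.N) :
    ∃ i ≤ v.length, (v.take i).count GridStep.N = y ∧
      (v.take i).count GridStep.E = rowAbscissa v y := by
  induction v generalizing y with
  | nil => exact ⟨0, by simp, by simp at h ⊢; omega, by simp [rowAbscissa]⟩
  | cons s v ih =>
    cases s
    · cases y with
      | zero => exact ⟨0, by simp [rowAbscissa]⟩
      | succ y =>
        obtain ⟨i, hi, h1, h2⟩ := ih y (by simpa using h)
        exact ⟨i + 1, by simpa using hi, by simpa using h1, by simpa [rowAbscissa] using h2⟩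
    · obtain ⟨i, hi, h1, h2⟩ := ih y (by simpa using h)
      exact ⟨i + 1, by simpa using hi, by simpa using h1, by simpa [rowAbscissa] using h2⟩

theorem rowEnd_eq_rowAbscissa (v : GridPath) (y : ℕ) (h : y ≤ v.count GridStep.N) :
    rowEnd v y = rowAbscissa v y := by
  apply le_antisymm
  · refine Finset.sup_le fun i hi => ?_
    rw [Finset.mem_filter] at hi
    rw [← hi.2]
    exact count_take_le_rowAbscissa v i
  · obtain ⟨i, hi, h1, h2⟩ := exists_count_take_eq_rowAbscissa v y h
    rw [← h2]
    exact Finset.le_sup (f := fun i => (endpoint (v.take i)).1)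
      (Finset.mem_filter.2 ⟨Finset.mem_range.2 (by omega), h1⟩)

theorem length_eq_count (w : GridPath) :
    w.length = w.count GridStep.E + w.count GridStep.N := by
  induction w with
  | nil => rfl
  | cons s w ih => cases s <;> simp [ih] <;> omega

/-- The elements of `Tam v` are the paths of `IsOver v`. -/
theorem isOver_iff (v w : GridPath) :
    IsOver v w ↔ w.endpoint = v.endpoint ∧ w.WeaklyAbove v := by
  simp only [IsOver, endpoint, Prod.mk.injEq, and_assoc, WeaklyAbove]
  refine and_congr_right fun hE => and_congr_right fun hN => ?_
  have hlen : ∀ i, (w.take i).count GridStep.E + (w.take i).count GridStep.N =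
      (v.take i).count GridStep.E + (v.take i).count GridStep.N := fun i => by
    rw [← length_eq_count, ← length_eq_count, List.length_take, List.length_take,
      length_eq_count w, length_eq_count v, hE, hN]
  refine forall_congr' fun i => ?_
  have h := hlen i
  have h1 := count_take_le_rowAbscissa v i
  rw [slack]
  constructor
  · intro h2
    by_contra! h3
    have := rowAbscissa_le_count_take v i _ h3
    omega
  · intro h2
    have := rowAbscissa_mono v h2
    omega

theorem slack_append_E (v p : GridPath) : slack v (p ++ [GridStep.E]) = slack v p - 1 := by
  simp [slack]; ring

theorem slack_le_slack_append_N (v p : GridPath) : slack v p ≤ slack v (p ++ [GridStep.N]) := by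
  have := rowAbscissa_le_succ v (p.count GridStep.N)
  simp [slack]; omega

theorem slack_sub_one_le (v p : GridPath) (s : GridStep) : slack v p - 1 ≤ slack v (p ++ [s]) := by
  cases s
  · linarith [slack_le_slack_append_N v p]
  · rw [slack_append_E]

theorem slack_congr {v p q : GridPath} (h : p.Perm q) : slack v p = slack v q := by
  rw [slack, slack, h.count_eq, h.count_eq]

/-- Along a path the distance to `v` drops by at most one per step, so it stays above its initial
value until it returns to it. -/
theorem slack_lt_of_ne {v p b : GridPath} (hb : b.head? = some GridStep.N)
    (h : ∀ j, 0 < j → j < b.length → slack v (p ++ b.take j) ≠ slack v p) (j : ℕ) (h0 : 0 < j)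
    (hj : j < b.length) : slack v p < slack v (p ++ b.take j) := by
  induction j, Nat.succ_le_of_lt h0 using Nat.le_induction with
  | base =>
    obtain ⟨b', rfl⟩ : ∃ b', b = GridStep.N :: b' := by
      cases b <;> simp_all
    have h1 := slack_le_slack_append_N v p
    have h2 := h 1 (by omega) hj
    simp only [List.take_succ_cons, List.take_zero, Nat.succ_eq_add_one, zero_add] at h2 ⊢
    exact lt_of_le_of_ne h1 h2.symm
  | succ j hj' ih =>
    have h1 := ih (by omega) (by omega)
    have h2 := h (j + 1) (by omega) hj
    have h3 := slack_sub_one_le v (p ++ b.take j) b[j]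
    rw [List.append_assoc, List.take_append_getElem] at h3
    omega

theorem IsOver.horiz_eq {v w : GridPath} (hw : IsOver v w) {p : GridPath} (hp : p <+: w) :
    (horiz v (endpoint p) : ℤ) = slack v p := by
  obtain ⟨c, rfl⟩ := hp
  have h1 : p.count GridStep.N ≤ v.count GridStep.N := by
    rw [← hw.2.1, List.count_append]; omega
  have h2 := hw.2.2 p.length
  rw [List.take_left, slack] at h2
  rw [horiz, slack]
  simp only [endpoint]
  rw [rowEnd_eq_rowAbscissa v _ h1]
  omega

/-- On `Tam v`, the covering relation with truncated distances is `Rotation`. -/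
theorem IsOver.rotates_iff {v w : GridPath} (hw : IsOver v w) (w' : GridPath) :
    Rotates v w w' ↔ Rotation v w w' := by
  refine exists_congr fun a => exists_congr fun b => exists_congr fun c => ?_
  refine and_congr_right fun h1 => and_congr_right fun _ => and_congr_right fun hb => ?_
  have e1 := hw.horiz_eq (p := a ++ [GridStep.E]) ⟨b ++ c, by simp [h1]⟩
  have e2 := hw.horiz_eq (p := a ++ [GridStep.E] ++ b) ⟨c, by simp [h1]⟩
  have e3 : ∀ j, (horiz v (endpoint (a ++ [GridStep.E] ++ b.take j)) : ℤ) =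
      slack v (a ++ [GridStep.E] ++ b.take j) := fun j =>
    hw.horiz_eq ⟨b.drop j ++ c, by rw [h1]; simp [← List.append_assoc (b.take j)]⟩
  refine and_congr (by rw [← e1, ← e2, Nat.cast_inj]) ?_
  constructor
  · intro h
    refine fun j => slack_lt_of_ne hb (fun j h0 hj => ?_) j
    rw [← e1, ← e3]
    exact fun h' => h j h0 hj (by exact_mod_cast h')
  · intro h j h0 hj h'
    have := h j h0 hj
    rw [← e1, ← e3, h'] at this
    exact lt_irrefl _ this

theorem slack_take_rotation_outside {v a b c : GridPath} {i : ℕ}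
    (hi : i ≤ a.length ∨ a.length + b.length < i) :
    slack v ((a ++ b ++ [GridStep.E] ++ c).take i) =
      slack v ((a ++ [GridStep.E] ++ b ++ c).take i) := by
  rcases hi with hi | hi
  · simp only [List.append_assoc, List.take_append_of_le_length hi]
  · obtain ⟨j, rfl⟩ := Nat.exists_eq_add_of_le (Nat.succ_le_of_lt hi)
    refine slack_congr ?_
    have e1 : (a ++ b ++ [GridStep.E]).length = (a.length + b.length).succ := by simp; omega
    have e2 : (a ++ [GridStep.E] ++ b).length = (a.length + b.length).succ := by simp; omega
    rw [← e1, List.take_length_add_append, e1, ← e2, List.take_length_add_append]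
    refine List.Perm.append_right _ ?_
    simp only [List.append_assoc]
    exact List.Perm.append_left _ List.perm_append_comm

theorem slack_take_rotation_inside {v a b c : GridPath} {i : ℕ}
    (h1 : a.length ≤ i) (h2 : i ≤ a.length + b.length) :
    slack v ((a ++ b ++ [GridStep.E] ++ c).take i) =
      slack v ((a ++ [GridStep.E] ++ b ++ c).take (i + 1)) + 1 := by
  obtain ⟨j, rfl⟩ := Nat.exists_eq_add_of_le h1
  have e1 : (a ++ [GridStep.E]).length = a.length + 1 := by simp
  rw [show a.length + j + 1 = (a ++ [GridStep.E]).length + j by simp; omega,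
    List.append_assoc (a ++ [GridStep.E]), List.take_length_add_append, List.append_assoc,
    List.append_assoc, List.take_length_add_append,
    List.take_append_of_le_length (by omega : j ≤ b.length),
    List.take_append_of_le_length (by omega : j ≤ b.length)]
  have : slack v (a ++ [GridStep.E] ++ b.take j) = slack v (a ++ b.take j ++ [GridStep.E]) := by
    refine slack_congr ?_
    simp only [List.append_assoc]
    exact List.Perm.append_left _ List.perm_append_comm
  rw [this, slack_append_E]
  ring

theorem IsOver.rotation {v w w' : GridPath} (hw : IsOver v w) (h : Rotation v w w') :
    IsOver v w' := by
  obtain ⟨a, b, c, rfl, rfl, -, -, -⟩ := h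
  refine ⟨?_, ?_, fun i => ?_⟩
  · rw [← hw.1]; simp; omega
  · rw [← hw.2.1]; simp
  · by_cases hi : i ≤ a.length ∨ a.length + b.length < i
    · rw [slack_take_rotation_outside hi]; exact hw.2.2 i
    · push Not at hi
      rw [slack_take_rotation_inside hi.1.le hi.2]
      linarith [hw.2.2 (i + 1)]

/-- The indices of the points of `w` at distance zero from `v`. -/
def contacts (v w : GridPath) : Finset ℕ :=
  (Finset.range (w.length + 1)).filter fun i => slack v (w.take i) = 0

theorem mem_contacts {v w : GridPath} {i : ℕ} :
    i ∈ contacts v w ↔ i ≤ w.length ∧ slack v (w.take i) = 0 := by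
  simp [contacts]

/-- A rotation creates no contact, and the contacts that it preserves lie outside the moved
part. -/
theorem contacts_rotation {v a b c : GridPath} {i : ℕ}
    (hw : IsOver v (a ++ [GridStep.E] ++ b ++ c))
    (hi : i ∈ contacts v (a ++ b ++ [GridStep.E] ++ c)) :
    i ∈ contacts v (a ++ [GridStep.E] ++ b ++ c) ∧ (i ≤ a.length ∨ a.length + b.length < i) := by
  rw [mem_contacts] at hi ⊢
  have hout : i ≤ a.length ∨ a.length + b.length < i := by
    by_contra! h
    have := hw.2.2 (i + 1)
    have h2 := hi.2
    rw [slack_take_rotation_inside h.1.le h.2] at h2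
    omega
  refine ⟨⟨?_, ?_⟩, hout⟩
  · have := hi.1; simp at this ⊢; omega
  · rw [← slack_take_rotation_outside hout]; exact hi.2

theorem IsOver.reflTransGen {v w w' : GridPath} (hw : IsOver v w)
    (h : Relation.ReflTransGen (Rotation v) w w') : IsOver v w' := by
  induction h with
  | refl => exact hw
  | tail _ h ih => exact ih.rotation h

theorem contacts_subset_of_reflTransGen {v w w' : GridPath} (hw : IsOver v w)
    (h : Relation.ReflTransGen (Rotation v) w w') : contacts v w' ⊆ contacts v w := by
  induction h with
  | refl => exact subset_rfl
  | tail h1 h ih =>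
    refine subset_trans (fun i hi => ?_) ih
    have hw' := hw.reflTransGen h1
    obtain ⟨a, b, c, rfl, rfl, -, -, -⟩ := h
    exact (contacts_rotation hw' hi).1

end GridPath

open GridPath

theorem Tam.isOver {v : GridPath} (w : Tam v) : IsOver v w.1 :=
  (isOver_iff _ _).2 w.2

/-- Rotations of words stay in `Tam v`, so the order can be computed on words. -/
theorem Tam.le_iff {v : GridPath} (w w' : Tam v) :
    w ≤ w' ↔ Relation.ReflTransGen (Rotation v) w.1 w'.1 := by
  constructor
  · intro h
    change Relation.ReflTransGen _ w w' at h
    induction h with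
    | refl => exact Relation.ReflTransGen.refl
    | tail _ h ih => exact ih.tail (((Tam.isOver _).rotates_iff _).1 h)
  · suffices key : ∀ u, Relation.ReflTransGen (Rotation v) w.1 u → ∀ hu, w ≤ ⟨u, hu⟩ from
      fun h => key _ h _
    intro u h
    induction h with
    | refl => exact fun _ => Relation.ReflTransGen.refl
    | tail h1 h2 ih =>
      intro hu
      have h3 := w.isOver.reflTransGen h1
      exact Relation.ReflTransGen.tail (ih ((isOver_iff _ _).1 h3)) ((h3.rotates_iff _).2 h2)

/-! ### Recursive structure of the order -/

namespace GridPath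

/-- The word obtained from `w` by inserting an east step after `k` steps. -/
def insertEast (w : GridPath) (k : ℕ) : GridPath :=
  w.take k ++ GridStep.E :: w.drop k

theorem insertEast_append (p q : GridPath) :
    insertEast (p ++ q) p.length = p ++ GridStep.E :: q := by
  simp [insertEast]

theorem slack_cons_E (v p : GridPath) : slack (GridStep.E :: v) p = slack v p + 1 := by
  simp [slack, rowAbscissa]; ring

theorem slack_cons_N (v p : GridPath) :
    slack (GridStep.N :: v) (GridStep.N :: p) = slack v p := by
  simp [slack, rowAbscissa]

theorem slack_cons_E_append_cons_E (v p r : GridPath) :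
    slack (GridStep.E :: v) (p ++ GridStep.E :: r) = slack v (p ++ r) := by
  simp [slack, rowAbscissa]; ring

theorem IsOver.slack_nonneg {v w p : GridPath} (hw : IsOver v w) (hp : p <+: w) :
    0 ≤ slack v p := by
  obtain ⟨c, rfl⟩ := hp
  simpa using hw.2.2 p.length

theorem slack_self_of_isOver {v w : GridPath} (hw : IsOver v w) : slack v w = 0 := by
  rw [slack, hw.1, hw.2.1, rowAbscissa_count_N]; simp

theorem exists_append_of_mem_contacts {v w : GridPath} {k : ℕ} (hk : k ∈ contacts v w) :
    ∃ p q, w = p ++ q ∧ p.length = k ∧ slack v p = 0 := by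
  rw [mem_contacts] at hk
  exact ⟨w.take k, w.drop k, by simp, by simp [hk.1], hk.2⟩

theorem length_mem_contacts {v p : GridPath} (q : GridPath) :
    p.length ∈ contacts v (p ++ q) ↔ slack v p = 0 := by
  simp [mem_contacts]

theorem slack_take_insertEast_of_le {v w : GridPath} {k i : ℕ} (hk : k ≤ w.length) (hi : i ≤ k) :
    slack (GridStep.E :: v) ((insertEast w k).take i) = slack v (w.take i) + 1 := by
  rw [slack_cons_E, insertEast, List.take_append_of_le_length (by simp; omega), List.take_take,
    min_eq_left hi]

theorem slack_take_insertEast_succ {v w : GridPath} {k i : ℕ} (hk : k ≤ w.length) (hi : k ≤ i) :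
    slack (GridStep.E :: v) ((insertEast w k).take (i + 1)) = slack v (w.take i) := by
  obtain ⟨j, rfl⟩ := Nat.exists_eq_add_of_le hi
  obtain ⟨p, q, rfl, rfl⟩ : ∃ p q : GridPath, w = p ++ q ∧ p.length = k :=
    ⟨w.take k, w.drop k, by simp, by simp [hk]⟩
  rw [insertEast_append, add_assoc, List.take_length_add_append, List.take_length_add_append,
    List.take_succ_cons, slack_cons_E_append_cons_E]

theorem length_insertEast (w : GridPath) (k : ℕ) : (insertEast w k).length = w.length + 1 := by
  simp only [insertEast, List.length_append, List.length_cons, List.length_take, List.length_drop]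
  omega

theorem IsOver.insertEast {v w : GridPath} (hw : IsOver v w) {k : ℕ} (hk : k ∈ contacts v w) :
    IsOver (GridStep.E :: v) (insertEast w k) := by
  have hkl := (mem_contacts.1 hk).1
  refine ⟨?_, ?_, fun i => ?_⟩
  · have : (w.take k ++ w.drop k).count GridStep.E = v.count GridStep.E := by simp [hw.1]
    rw [List.count_append] at this
    simp [GridPath.insertEast]; omega
  · have : (w.take k ++ w.drop k).count GridStep.N = v.count GridStep.N := by simp [hw.2.1]
    rw [List.count_append] at this
    simp [GridPath.insertEast]; omega
  · rcases le_or_gt i k with hi | hi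
    · rw [slack_take_insertEast_of_le hkl hi]
      linarith [hw.2.2 i]
    · obtain ⟨i, rfl⟩ := Nat.exists_eq_succ_of_ne_zero (by omega : i ≠ 0)
      rw [Nat.succ_eq_add_one, slack_take_insertEast_succ hkl (by omega)]
      exact hw.2.2 i

/-- The east step inserted at `k` leads to the first contact of the new word, and the later contacts
are those of `w`, shifted by one. -/
theorem mem_contacts_insertEast {v w : GridPath} (hw : IsOver v w) {k : ℕ} (hk : k ≤ w.length)
    (i : ℕ) : i ∈ contacts (GridStep.E :: v) (insertEast w k) ↔
      ∃ j ∈ contacts v w, k ≤ j ∧ j + 1 = i := by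
  simp only [mem_contacts, length_insertEast]
  constructor
  · rintro ⟨h1, h2⟩
    rcases le_or_gt i k with hi | hi
    · rw [slack_take_insertEast_of_le hk hi] at h2
      have := hw.2.2 i
      omega
    · obtain ⟨i, rfl⟩ := Nat.exists_eq_succ_of_ne_zero (by omega : i ≠ 0)
      rw [Nat.succ_eq_add_one, slack_take_insertEast_succ hk (by omega)] at h2
      exact ⟨i, ⟨by omega, h2⟩, by omega, rfl⟩
  · rintro ⟨j, ⟨h1, h2⟩, h3, rfl⟩
    exact ⟨by omega, by rw [slack_take_insertEast_succ hk h3, h2]⟩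

theorem insertEast_injective {v w w' : GridPath} {k k' : ℕ} (hw : IsOver v w) (hw' : IsOver v w')
    (hk : k ∈ contacts v w) (hk' : k' ∈ contacts v w')
    (h : insertEast w k = insertEast w' k') : w = w' ∧ k = k' := by
  have hkl := (mem_contacts.1 hk).1
  have hkl' := (mem_contacts.1 hk').1
  have h1 : k + 1 ∈ contacts (GridStep.E :: v) (insertEast w k) :=
    (mem_contacts_insertEast hw hkl _).2 ⟨k, hk, le_rfl, rfl⟩
  have h2 : k' + 1 ∈ contacts (GridStep.E :: v) (insertEast w' k') :=
    (mem_contacts_insertEast hw' hkl' _).2 ⟨k', hk', le_rfl, rfl⟩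
  rw [h, mem_contacts_insertEast hw' hkl'] at h1
  rw [← h, mem_contacts_insertEast hw hkl] at h2
  obtain rfl : k = k' := by
    obtain ⟨_, _, _, _⟩ := h1
    obtain ⟨_, _, _, _⟩ := h2
    omega
  refine ⟨?_, rfl⟩
  obtain ⟨p, q, rfl, rfl⟩ : ∃ p q : GridPath, w = p ++ q ∧ p.length = k :=
    ⟨w.take k, w.drop k, by simp, by simp [hkl]⟩
  obtain ⟨p', q', rfl, hp'⟩ : ∃ p' q' : GridPath, w' = p' ++ q' ∧ p'.length = p.length :=
    ⟨w'.take p.length, w'.drop p.length, by simp, by simp [hkl']⟩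
  rw [insertEast_append, ← hp', insertEast_append] at h
  obtain ⟨h3, h4⟩ := List.append_inj h hp'.symm
  simp_all

/-- Removing the east step that leads to the first contact. -/
theorem IsOver.exists_insertEast {v x : GridPath} (hx : IsOver (GridStep.E :: v) x) :
    ∃ w k, IsOver v w ∧ k ∈ contacts v w ∧ x = GridPath.insertEast w k := by
  have hex : ∃ i, slack (GridStep.E :: v) (x.take i) = 0 :=
    ⟨x.length, by rw [List.take_length]; exact slack_self_of_isOver hx⟩
  classical
  obtain ⟨t, ht, htmin⟩ : ∃ t, slack (GridStep.E :: v) (x.take t) = 0 ∧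
      ∀ i < t, slack (GridStep.E :: v) (x.take i) ≠ 0 :=
    ⟨Nat.find hex, Nat.find_spec hex, fun i hi => Nat.find_min hex hi⟩
  have htl : t ≤ x.length := by
    by_contra! h
    exact htmin _ h (by rw [List.take_length]; exact slack_self_of_isOver hx)
  have ht0 : t ≠ 0 := by
    rintro rfl
    rw [slack_cons_E, slack] at ht
    simp at ht
    omega
  obtain ⟨k, rfl⟩ := Nat.exists_eq_succ_of_ne_zero ht0
  have hk : k < x.length := htl
  have h1 : 0 < slack (GridStep.E :: v) (x.take k) :=
    lt_of_le_of_ne (hx.2.2 k) (htmin k (by omega)).symm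
  have hstep : x.take (k + 1) = x.take k ++ [x[k]] := (List.take_append_getElem hk).symm
  have hE : x[k] = GridStep.E := by
    cases h : x[k]
    · rw [Nat.succ_eq_add_one, hstep, h] at ht
      have := slack_le_slack_append_N (GridStep.E :: v) (x.take k)
      omega
    · rfl
  have hxk : x = x.take k ++ GridStep.E :: x.drop (k + 1) := by
    conv_lhs => rw [← List.take_append_drop k x, List.drop_eq_getElem_cons hk, hE]
  obtain ⟨p, q, hp, hpq⟩ : ∃ p q : GridPath, p.length = k ∧ x = p ++ GridStep.E :: q :=
    ⟨x.take k, x.drop (k + 1), by simp; omega, hxk⟩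
  clear hxk hstep hE hk
  subst hp
  have hx' : x = GridPath.insertEast (p ++ q) p.length := by rw [hpq, insertEast_append]
  have hl : p.length ≤ (p ++ q).length := by simp
  refine ⟨p ++ q, p.length, ⟨?_, ?_, fun i => ?_⟩, ?_, hx'⟩
  · have := hx.1; simp [hpq] at this ⊢; omega
  · have := hx.2.1; simp [hpq] at this ⊢; omega
  · rcases le_or_gt p.length i with hi | hi
    · have := hx.2.2 (i + 1)
      rwa [hx', slack_take_insertEast_succ hl hi] at this
    · have h2 := lt_of_le_of_ne (hx.2.2 i) (htmin i (by omega)).symm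
      rw [hx', slack_take_insertEast_of_le hl hi.le] at h2
      omega
  · rw [mem_contacts, ← slack_take_insertEast_succ hl le_rfl, ← hx']
    exact ⟨hl, ht⟩

/-- The inserted east step can be moved from one contact to a later one by rotations. -/
theorem reflTransGen_insertEast_append {v p b q : GridPath} (hw : IsOver v (p ++ b ++ q))
    (hp : slack v p = 0) (hb : slack v (p ++ b) = 0) :
    Relation.ReflTransGen (Rotation (GridStep.E :: v))
      (p ++ GridStep.E :: (b ++ q)) (p ++ b ++ GridStep.E :: q) := by
  induction hn : b.length using Nat.strong_induction_on generalizing p b with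
  | _ n ih =>
    rcases b with _ | ⟨s, b⟩
    · simpa using Relation.ReflTransGen.refl
    · have hs : s = GridStep.N := by
        cases s
        · rfl
        · have := hw.slack_nonneg (p := p ++ [GridStep.E]) ⟨b ++ q, by simp⟩
          rw [slack_append_E] at this
          omega
      subst hs
      have hex : ∃ j, slack v (p ++ GridStep.N :: b.take j) = 0 := ⟨b.length, by simpa using hb⟩
      classical
      obtain ⟨j, hj, hjmin⟩ : ∃ j, slack v (p ++ GridStep.N :: b.take j) = 0 ∧
          ∀ i < j, slack v (p ++ GridStep.N :: b.take i) ≠ 0 :=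
        ⟨Nat.find hex, Nat.find_spec hex, fun i hi => Nat.find_min hex hi⟩
      have hjl : j ≤ b.length := by
        by_contra! h
        exact hjmin _ h (by simpa using hb)
      obtain ⟨b₁, b₂, hb₁, rfl⟩ : ∃ b₁ b₂ : GridPath, b₁.length = j ∧ b = b₁ ++ b₂ :=
        ⟨b.take j, b.drop j, by simp [hjl], by simp⟩
      subst hb₁
      rw [List.take_left] at hj
      have h1 : Rotation (GridStep.E :: v) (p ++ GridStep.E :: (GridStep.N :: (b₁ ++ b₂) ++ q))
          ((p ++ GridStep.N :: b₁) ++ GridStep.E :: (b₂ ++ q)) := by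
        refine ⟨p, GridStep.N :: b₁, b₂ ++ q, by simp, by simp, rfl, ?_, ?_⟩
        · rw [List.append_assoc, List.singleton_append, slack_cons_E_append_cons_E,
            slack_cons_E_append_cons_E, hj, List.append_nil, hp]
        · intro i h0 hi
          obtain ⟨i, rfl⟩ := Nat.exists_eq_succ_of_ne_zero h0.ne'
          have hi : i < b₁.length := by simpa using hi
          rw [List.append_assoc, List.singleton_append, slack_cons_E_append_cons_E,
            slack_cons_E_append_cons_E, List.append_nil, hp]
          have h2 := hjmin i hi
          rw [List.take_append_of_le_length hi.le] at h2
          refine lt_of_le_of_ne (hw.slack_nonneg ?_) h2.symm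
          refine ⟨b₁.drop i ++ (b₂ ++ q), ?_⟩
          simp [← List.append_assoc (b₁.take i)]
      refine Relation.ReflTransGen.head h1 ?_
      have h2 := ih b₂.length (by subst hn; simp) (p := p ++ GridStep.N :: b₁) (b := b₂)
        (by simpa using hw) hj (by simpa using hb) rfl
      simpa using h2

/-- A rotation lifts to the words with an east step inserted at a contact that survives the
rotation. -/
theorem Rotation.insertEast {v w w' : GridPath} (h : Rotation v w w') (hw : IsOver v w) {k : ℕ}
    (hk : k ∈ contacts v w') :
    Rotation (GridStep.E :: v) (GridPath.insertEast w k) (GridPath.insertEast w' k) := by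
  obtain ⟨a, b, c, rfl, rfl, hb, h1, h2⟩ := h
  have hkl := (mem_contacts.1 hk).1
  rcases (contacts_rotation hw hk).2 with hk' | hk'
  · obtain ⟨a₁, a₂, rfl, rfl⟩ : ∃ a₁ a₂ : GridPath, a = a₁ ++ a₂ ∧ a₁.length = k :=
      ⟨a.take k, a.drop k, by simp, by simp [hk']⟩
    simp only [List.append_assoc, insertEast_append] at h1 h2 ⊢
    refine ⟨a₁ ++ GridStep.E :: a₂, b, c, by simp, by simp, hb, ?_, ?_⟩
    · simpa [slack_cons_E_append_cons_E] using h1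
    · simpa [slack_cons_E_append_cons_E] using h2
  · obtain ⟨j, rfl⟩ := Nat.exists_eq_add_of_le (Nat.succ_le_of_lt hk')
    obtain ⟨c₁, c₂, rfl, rfl⟩ : ∃ c₁ c₂ : GridPath, c = c₁ ++ c₂ ∧ c₁.length = j :=
      ⟨c.take j, c.drop j, by simp, by simp at hkl ⊢; omega⟩
    have e1 : (a.length + b.length).succ + c₁.length =
      (a ++ [GridStep.E] ++ b ++ c₁).length := by simp; omega
    have e2 : (a.length + b.length).succ + c₁.length =
      (a ++ b ++ [GridStep.E] ++ c₁).length := by simp; omega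
    refine ⟨a, b, c₁ ++ GridStep.E :: c₂, ?_, ?_, hb, ?_, ?_⟩
    · rw [e1, ← List.append_assoc, insertEast_append]
      simp
    · rw [e2, ← List.append_assoc, insertEast_append]
      simp
    · simpa only [slack_cons_E, add_left_inj] using h1
    · simpa only [slack_cons_E, add_lt_add_iff_right] using h2

/-- Every rotation of a word with an inserted east step either moves this step to a later contact
or rotates the rest of the word. -/
theorem Rotation.of_insertEast {v w x : GridPath} {k : ℕ} (hw : IsOver v w)
    (hk : k ∈ contacts v w) (h : Rotation (GridStep.E :: v) (GridPath.insertEast w k) x) :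
    ∃ w' k', k' ∈ contacts v w' ∧ x = GridPath.insertEast w' k' ∧
      Relation.ReflTransGen (Rotation v) w w' ∧ k ≤ k' := by
  obtain ⟨p, q, rfl, rfl, hp⟩ := exists_append_of_mem_contacts hk
  obtain ⟨a, b, c, h0, rfl, hb, h1, h2⟩ := h
  rw [insertEast_append, List.append_assoc, List.append_assoc, List.singleton_append] at h0
  -- The rotated step is the inserted one.
  have special : p = a → q = b ++ c → ∃ w' k', k' ∈ contacts v w' ∧
      a ++ b ++ [GridStep.E] ++ c = GridPath.insertEast w' k' ∧
      Relation.ReflTransGen (Rotation v) (p ++ q) w' ∧ p.length ≤ k' := by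
    rintro rfl rfl
    refine ⟨p ++ b ++ c, (p ++ b).length, ?_, ?_, by simpa using .refl, by simp⟩
    · rw [length_mem_contacts]
      simpa [slack_cons_E_append_cons_E, hp] using h1
    · rw [insertEast_append]; simp
  -- The rotated step belongs to `w`, and the inserted one stays in place.
  have rest : ∀ w' x, p.length ∈ contacts v w' → x = GridPath.insertEast w' p.length →
      Rotation v (p ++ q) w' → ∃ w' k', k' ∈ contacts v w' ∧
      x = GridPath.insertEast w' k' ∧
      Relation.ReflTransGen (Rotation v) (p ++ q) w' ∧ p.length ≤ k' :=
    fun w' x h3 h4 h5 => ⟨w', p.length, h3, h4, .single h5, le_rfl⟩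
  rcases List.append_eq_append_iff.1 h0 with ⟨a', rfl, ha'⟩ | ⟨p', rfl, hp'⟩
  · rcases a' with _ | ⟨s, a'⟩
    · simp only [List.nil_append, List.cons.injEq, true_and] at ha'
      exact special (by simp) ha'
    · simp only [List.cons_append, List.cons.injEq] at ha'
      obtain ⟨rfl, rfl⟩ := ha'
      refine rest (p ++ (a' ++ b ++ [GridStep.E] ++ c)) _ ((length_mem_contacts _).2 hp) ?_
        ⟨p ++ a', b, c, by simp, by simp, hb, ?_, ?_⟩
      · rw [insertEast_append]; simp
      · simpa [slack_cons_E_append_cons_E] using h1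
      · simpa [slack_cons_E_append_cons_E] using h2
  · rcases p' with _ | ⟨s, p'⟩
    · simp only [List.nil_append, List.cons.injEq, true_and] at hp'
      exact special (by simp) hp'.symm
    · simp only [List.cons_append, List.cons.injEq] at hp'
      obtain ⟨rfl, hp'⟩ := hp'
      have key : ∀ d, p' = b ++ d → c = d ++ GridStep.E :: q → ∃ w' k', k' ∈ contacts v w' ∧
          a ++ b ++ [GridStep.E] ++ c = GridPath.insertEast w' k' ∧
          Relation.ReflTransGen (Rotation v) (a ++ GridStep.E :: p' ++ q) w' ∧
          (a ++ GridStep.E :: p').length ≤ k' := by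
        rintro d rfl rfl
        have e : (a ++ GridStep.E :: (b ++ d)).length = (a ++ b ++ [GridStep.E] ++ d).length := by
          simp; omega
        refine rest (a ++ b ++ [GridStep.E] ++ d ++ q) _ ?_ ?_
          ⟨a, b, d ++ q, by simp, by simp, hb, ?_, ?_⟩
        · rw [e, length_mem_contacts, ← hp]
          refine slack_congr ?_
          simp only [List.append_assoc]
          refine List.Perm.append_left _ ?_
          simp
        · rw [e, insertEast_append]; simp
        · simpa only [slack_cons_E, add_left_inj] using h1
        · simpa only [slack_cons_E, add_lt_add_iff_right] using h2
      rcases List.append_eq_append_iff.1 hp' with ⟨d, h3, h4⟩ | ⟨d, h3, h4⟩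
      · exact key d h3 h4
      · rcases d with _ | ⟨s, d⟩
        · exact key [] (by simpa using h3.symm) (by simpa using h4.symm)
        · simp only [List.cons_append, List.cons.injEq] at h4
          obtain ⟨rfl, rfl⟩ := h4
          -- The moved part cannot cross the contact.
          exfalso
          have h5 := hw.slack_nonneg (p := a ++ [GridStep.E])
            ⟨p' ++ (d ++ c), by simp⟩
          have h6 : slack (GridStep.E :: v)
              (a ++ [GridStep.E] ++ b.take (p'.length + 1)) = 0 := by
            rw [h3, List.take_length_add_append, List.take_succ_cons, List.take_zero, ← hp,
              show a ++ [GridStep.E] ++ (p' ++ [GridStep.E]) =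
                (a ++ GridStep.E :: p') ++ GridStep.E :: [] by simp,
              slack_cons_E_append_cons_E, List.append_nil]
          have h7 := slack_cons_E v (a ++ [GridStep.E])
          rcases lt_or_ge (p'.length + 1) b.length with h8 | h8
          · have := h2 _ (by omega) h8
            omega
          · rw [List.take_of_length_le h8] at h6
            omega

/-- Inserting an east step turns the pairs of an element of `Tam v` and one of its contacts, with
the product order, into the elements of `Tam (E :: v)`. -/
theorem reflTransGen_insertEast_iff {v w w' : GridPath} {k k' : ℕ} (hw : IsOver v w)
    (hw' : IsOver v w') (hk : k ∈ contacts v w) (hk' : k' ∈ contacts v w') :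
    Relation.ReflTransGen (Rotation (GridStep.E :: v)) (insertEast w k) (insertEast w' k') ↔
      Relation.ReflTransGen (Rotation v) w w' ∧ k ≤ k' := by
  constructor
  · intro h
    have key : ∀ x, Relation.ReflTransGen (Rotation (GridStep.E :: v)) (insertEast w k) x →
        ∃ u j, j ∈ contacts v u ∧ x = insertEast u j ∧
          Relation.ReflTransGen (Rotation v) w u ∧ k ≤ j := by
      intro x h
      induction h with
      | refl => exact ⟨w, k, hk, rfl, .refl, le_rfl⟩
      | tail _ h ih =>
        obtain ⟨u, j, hj, rfl, h1, h2⟩ := ih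
        obtain ⟨u', j', hj', rfl, h3, h4⟩ := h.of_insertEast (hw.reflTransGen h1) hj
        exact ⟨u', j', hj', rfl, h1.trans h3, h2.trans h4⟩
    obtain ⟨u, j, hj, h1, h2, h3⟩ := key _ h
    obtain ⟨rfl, rfl⟩ := insertEast_injective hw' (hw.reflTransGen h2) hk' hj h1
    exact ⟨h2, h3⟩
  · rintro ⟨h1, h2⟩
    have hk'' := contacts_subset_of_reflTransGen hw h1 hk'
    refine Relation.ReflTransGen.trans (b := insertEast w k') ?_ ?_
    · obtain ⟨p, q, rfl, rfl, hp⟩ := exists_append_of_mem_contacts hk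
      obtain ⟨j, rfl⟩ := Nat.exists_eq_add_of_le h2
      rw [mem_contacts, List.take_length_add_append] at hk''
      have e : p.length + j = (p ++ q.take j).length := by
        have := hk''.1; simp at this ⊢; omega
      have h3 := reflTransGen_insertEast_append (v := v) (p := p) (b := q.take j) (q := q.drop j)
        (by simpa using hw) hp hk''.2
      have e2 : insertEast (p ++ q) (p.length + j) = p ++ q.take j ++ GridStep.E :: q.drop j := by
        rw [e, ← insertEast_append]; simp
      rw [e2, insertEast_append]
      simpa using h3
    · clear hw' hk'' h2 hk
      induction h1 with
      | refl => exact .refl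
      | tail h3 h4 ih =>
        have hu := hw.reflTransGen h3
        refine .tail (ih ?_) (h4.insertEast hu hk')
        exact contacts_subset_of_reflTransGen hu (.single h4) hk'

theorem isOver_cons_N_iff {v x : GridPath} :
    IsOver (GridStep.N :: v) x ↔ ∃ w, IsOver v w ∧ x = GridStep.N :: w := by
  constructor
  · intro h
    rcases x with _ | ⟨s, w⟩
    · have := h.2.1; simp at this
    · cases s
      · refine ⟨w, ⟨?_, ?_, fun i => ?_⟩, rfl⟩
        · simpa using h.1
        · simpa using h.2.1
        · simpa [slack_cons_N] using h.2.2 (i + 1)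
      · have := h.2.2 1
        simp [slack, rowAbscissa] at this
  · rintro ⟨w, h, rfl⟩
    refine ⟨by simpa using h.1, by simpa using h.2.1, fun i => ?_⟩
    rcases i with _ | i
    · simp [slack, rowAbscissa]
    · simpa [slack_cons_N] using h.2.2 i

theorem mem_contacts_cons_N {v w : GridPath} {i : ℕ} :
    i ∈ contacts (GridStep.N :: v) (GridStep.N :: w) ↔ i = 0 ∨ ∃ j ∈ contacts v w, j + 1 = i := by
  rcases i with _ | i
  · simp [mem_contacts, slack, rowAbscissa]
  · simp [mem_contacts, slack_cons_N]

theorem rotation_cons_N_iff {v w x : GridPath} :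
    Rotation (GridStep.N :: v) (GridStep.N :: w) x ↔ ∃ w', Rotation v w w' ∧
      x = GridStep.N :: w' := by
  constructor
  · rintro ⟨a, b, c, h0, rfl, hb, h1, h2⟩
    rcases a with _ | ⟨s, a⟩
    · simp at h0
    · simp only [List.cons_append, List.cons.injEq] at h0 h1 h2
      obtain ⟨rfl, rfl⟩ := h0
      simp only [slack_cons_N] at h1 h2
      exact ⟨_, ⟨a, b, c, rfl, rfl, hb, h1, h2⟩, by simp⟩
  · rintro ⟨w', ⟨a, b, c, rfl, rfl, hb, h1, h2⟩, rfl⟩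
    exact ⟨GridStep.N :: a, b, c, by simp, by simp, hb, by simpa [slack_cons_N] using h1,
      by simpa [slack_cons_N] using h2⟩

theorem reflTransGen_cons_N_iff {v w w' : GridPath} :
    Relation.ReflTransGen (Rotation (GridStep.N :: v)) (GridStep.N :: w) (GridStep.N :: w') ↔
      Relation.ReflTransGen (Rotation v) w w' := by
  constructor
  · intro h
    have key : ∀ x, Relation.ReflTransGen (Rotation (GridStep.N :: v)) (GridStep.N :: w) x →
        ∃ u, x = GridStep.N :: u ∧ Relation.ReflTransGen (Rotation v) w u := by
      intro x h
      induction h with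
      | refl => exact ⟨w, rfl, .refl⟩
      | tail _ h ih =>
        obtain ⟨u, rfl, h1⟩ := ih
        obtain ⟨u', h2, rfl⟩ := rotation_cons_N_iff.1 h
        exact ⟨u', rfl, h1.tail h2⟩
    obtain ⟨u, h1, h2⟩ := key _ h
    simp only [List.cons.injEq, true_and] at h1
    rwa [h1]
  · intro h
    induction h with
    | refl => exact .refl
    | tail _ h ih => exact ih.tail (rotation_cons_N_iff.2 ⟨_, h, rfl⟩)

end GridPath

/-! ### Encoding by nested lists -/

/-- The cuts of a list `l`: the positions at which `l` splits into two nested lists, when `l` is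
nested. Position `0` is always a cut, and the positions `1, …, a` are not cuts of `a :: l`. -/
def cuts : List ℕ → Finset ℕ
  | [] => {0}
  | a :: l => insert 0 (((cuts l).filter fun e => a ≤ e).image fun e => e + 1)

/-- A list is nested when each entry `a` is a cut of the part of the list after it, so that the
blocks formed by `a` and the next `a` entries are nested or disjoint (these are the bracket
vectors of binary trees); this is `IsNestedPair l l`. In general the predicate says that both lists
are nested, have the same length and the same zero entries, and that the first is entrywise at most
the second. -/
def IsNestedPair : List ℕ → List ℕ → Prop
  | [], [] => True
  | a :: l, b :: m => IsNestedPair l m ∧ a ∈ cuts l ∧ b ∈ cuts m ∧ a ≤ b ∧ (a = 0 ↔ b = 0)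
  | _, _ => False

theorem IsNestedPair.left {l m : List ℕ} (h : IsNestedPair l m) : IsNestedPair l l := by
  induction l generalizing m with
  | nil => trivial
  | cons a l ih =>
    cases m with
    | nil => exact h.elim
    | cons b m => exact ⟨ih h.1, h.2.1, h.2.1, le_rfl, Iff.rfl⟩

theorem IsNestedPair.right {l m : List ℕ} (h : IsNestedPair l m) : IsNestedPair m m := by
  induction l generalizing m with
  | nil => cases m <;> [trivial; exact h.elim]
  | cons a l ih =>
    cases m with
    | nil => exact h.elim
    | cons b m => exact ⟨ih h.1, h.2.2.1, h.2.2.1, le_rfl, Iff.rfl⟩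

theorem IsNestedPair.length_eq {l m : List ℕ} (h : IsNestedPair l m) : l.length = m.length := by
  induction l generalizing m with
  | nil => cases m <;> [rfl; exact h.elim]
  | cons a l ih =>
    cases m with
    | nil => exact h.elim
    | cons b m => simpa using ih h.1

theorem IsNestedPair.antisymm {l m : List ℕ} (h : IsNestedPair l m) (h' : IsNestedPair m l) :
    l = m := by
  induction l generalizing m with
  | nil => cases m <;> [rfl; exact h.elim]
  | cons a l ih =>
    cases m with
    | nil => exact h.elim
    | cons b m => rw [ih h.1 h'.1, le_antisymm h.2.2.2.1 h'.2.2.2.1]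

theorem mem_cuts_cons {a : ℕ} {l : List ℕ} {e : ℕ} :
    e ∈ cuts (a :: l) ↔ e = 0 ∨ ∃ i ∈ cuts l, a ≤ i ∧ i + 1 = e := by
  simp [cuts, and_assoc]

namespace GridPath

/-- The path `v` for which a nested list encodes an element of `Tam v`: a zero entry gives a north
step and a positive one an east step. The last entry, which is always zero in a nested list, gives
no step. -/
def canopy : List ℕ → GridPath
  | [] => []
  | [_] => []
  | a :: b :: l => (if a = 0 then GridStep.N else GridStep.E) :: canopy (b :: l)

/-- The element of `Tam (canopy l)` encoded by the nested list `l`: a zero entry prepends a north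
step, and a positive entry `k + 1` inserts an east step after `k` steps. -/
def decode : List ℕ → GridPath
  | [] => []
  | [_] => []
  | 0 :: b :: l => GridStep.N :: decode (b :: l)
  | (k + 1) :: b :: l => insertEast (decode (b :: l)) k

theorem length_canopy (l : List ℕ) : (canopy l).length = l.length - 1 := by
  induction l with
  | nil => rfl
  | cons a l ih => cases l <;> simp_all [canopy]

theorem canopy_eq_of_isNestedPair {l m : List ℕ} (h : IsNestedPair l m) : canopy l = canopy m := by
  induction l generalizing m with
  | nil => cases m <;> [rfl; exact h.elim]
  | cons a l ih =>
    cases m with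
    | nil => exact h.elim
    | cons b m =>
      have h1 := ih h.1
      have h2 := h.1.length_eq
      have h3 : a = 0 ↔ b = 0 := h.2.2.2.2
      cases l <;> cases m
      · rfl
      · simp at h2
      · simp at h2
      · simp only [canopy, h1, h3]

/-- A nested list decodes to an element of `Tam (canopy l)`, and its positive cuts are the
contacts of this element, shifted by one. -/
theorem isOver_decode {l : List ℕ} (h0 : l ≠ []) (h : IsNestedPair l l) :
    IsOver (canopy l) (decode l) ∧
      ∀ e, e ∈ cuts l ↔ e = 0 ∨ ∃ i ∈ contacts (canopy l) (decode l), i + 1 = e := by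
  induction l with
  | nil => exact (h0 rfl).elim
  | cons a l ih =>
    rcases l with _ | ⟨b, l⟩
    · obtain ⟨-, ha, -⟩ := h
      obtain rfl : a = 0 := by simpa [cuts] using ha
      refine ⟨⟨rfl, rfl, fun i => by simp [canopy, decode, slack, rowAbscissa]⟩, fun e => ?_⟩
      simp [cuts, mem_contacts, canopy, decode, slack, rowAbscissa, eq_comm]
    · obtain ⟨h1, ha, -⟩ := h
      obtain ⟨h2, h3⟩ := ih (by simp) h1
      cases a with
      | zero =>
        refine ⟨isOver_cons_N_iff.2 ⟨_, h2, rfl⟩, fun e => ?_⟩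
        rw [mem_cuts_cons]
        simp only [canopy, decode, if_true, mem_contacts_cons_N, h3]
        refine or_congr_right ⟨?_, ?_⟩
        · rintro ⟨i, hi, -, rfl⟩
          exact ⟨i, hi, rfl⟩
        · rintro ⟨i, hi, rfl⟩
          exact ⟨i, hi, by omega, rfl⟩
      | succ k =>
        have hk : k ∈ contacts (canopy (b :: l)) (decode (b :: l)) := by
          simpa using (h3 (k + 1)).1 ha
        simp only [canopy, decode, if_neg (Nat.succ_ne_zero k)]
        refine ⟨h2.insertEast hk, fun e => ?_⟩
        simp only [mem_cuts_cons, mem_contacts_insertEast h2 (mem_contacts.1 hk).1, h3]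
        refine or_congr_right ⟨?_, ?_⟩
        · rintro ⟨i, rfl | ⟨j, hj, rfl⟩, hi, rfl⟩
          · omega
          · exact ⟨j + 1, ⟨j, hj, by omega, rfl⟩, rfl⟩
        · rintro ⟨i, ⟨j, hj, h4, rfl⟩, rfl⟩
          exact ⟨j + 1, Or.inr ⟨j, hj, rfl⟩, by omega, rfl⟩

theorem IsOver.exists_decode {v w : GridPath} (hw : IsOver v w) :
    ∃ l, l ≠ [] ∧ IsNestedPair l l ∧ canopy l = v ∧ decode l = w := by
  induction v generalizing w with
  | nil =>
    have h : w = [] := by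
      rw [← List.length_eq_zero_iff, length_eq_count, hw.1, hw.2.1]; simp
    exact ⟨[0], by simp, ⟨trivial, by simp [cuts], by simp [cuts], le_rfl, Iff.rfl⟩, rfl, h.symm⟩
  | cons s v ih =>
    cases s
    · obtain ⟨w, hw', rfl⟩ := isOver_cons_N_iff.1 hw
      obtain ⟨l, h0, hl, rfl, rfl⟩ := ih hw'
      obtain ⟨b, l, rfl⟩ := List.exists_cons_of_ne_nil h0
      have h1 := ((isOver_decode h0 hl).2 0).2 (Or.inl rfl)
      exact ⟨0 :: b :: l, by simp, ⟨hl, h1, h1, le_rfl, Iff.rfl⟩, rfl, rfl⟩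
    · obtain ⟨w, k, hw', hk, rfl⟩ := hw.exists_insertEast
      obtain ⟨l, h0, hl, rfl, rfl⟩ := ih hw'
      obtain ⟨b, l, rfl⟩ := List.exists_cons_of_ne_nil h0
      have h1 := ((isOver_decode h0 hl).2 (k + 1)).2 (Or.inr ⟨k, hk, rfl⟩)
      exact ⟨(k + 1) :: b :: l, by simp, ⟨hl, h1, h1, le_rfl, Iff.rfl⟩, rfl, rfl⟩

/-- Under the encoding by nested lists, the order of `Tam v` is the entrywise order. -/
theorem reflTransGen_decode_iff {l m : List ℕ} (hl0 : l ≠ []) (hl : IsNestedPair l l)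
    (hm0 : m ≠ []) (hm : IsNestedPair m m) (h : canopy l = canopy m) :
    Relation.ReflTransGen (Rotation (canopy l)) (decode l) (decode m) ↔ IsNestedPair l m := by
  induction l generalizing m with
  | nil => exact (hl0 rfl).elim
  | cons a l ih =>
    obtain ⟨b, m, rfl⟩ := List.exists_cons_of_ne_nil hm0
    have hlen := congrArg List.length h
    simp only [length_canopy, List.length_cons, Nat.add_sub_cancel] at hlen
    rcases l with _ | ⟨a', l⟩ <;> rcases m with _ | ⟨b', m⟩
    · obtain rfl : a = 0 := by simpa [cuts] using hl.2.1
      obtain rfl : b = 0 := by simpa [cuts] using hm.2.1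
      exact iff_of_true .refl hl
    · simp at hlen
    · simp at hlen
    · have h1 : (a = 0 ↔ b = 0) ∧ canopy (a' :: l) = canopy (b' :: m) := by
        simp only [canopy, List.cons.injEq] at h
        refine ⟨?_, h.2⟩
        have := h.1
        by_cases ha : a = 0 <;> by_cases hb : b = 0 <;> simp_all
      have h2 := ih (by simp) hl.1 (by simp) hm.1 h1.2
      obtain ⟨h3, h4⟩ := isOver_decode (by simp) hl.1
      obtain ⟨h5, h6⟩ := isOver_decode (by simp) hm.1
      have ha := hl.2.1
      have hb := hm.2.1
      rw [← h1.2] at h5 h6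
      have h7 : IsNestedPair (a :: a' :: l) (b :: b' :: m) ↔
          IsNestedPair (a' :: l) (b' :: m) ∧ a ≤ b :=
        ⟨fun h => ⟨h.1, h.2.2.2.1⟩, fun h => ⟨h.1, ha, hb, h.2, h1.1⟩⟩
      rw [h7, ← h2]
      rcases a with _ | k <;> rcases b with _ | j
      · simp only [canopy, decode, if_true, le_refl, and_true, reflTransGen_cons_N_iff]
      · simp at h1
      · simp at h1
      · have hk : k ∈ contacts (canopy (a' :: l)) (decode (a' :: l)) := by
          simpa using (h4 (k + 1)).1 ha
        have hj : j ∈ contacts (canopy (a' :: l)) (decode (b' :: m)) := by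
          simpa using (h6 (j + 1)).1 hb
        simp only [canopy, decode, if_neg (Nat.succ_ne_zero k)]
        rw [reflTransGen_insertEast_iff h3 h5 hk hj, Nat.succ_le_succ_iff]

end GridPath

/-- The pairs of nested lists of length `n` satisfying `IsNestedPair`. -/
def nestedPairs : ℕ → Finset (List ℕ × List ℕ)
  | 0 => {([], [])}
  | n + 1 => (nestedPairs n).biUnion fun p =>
      ((cuts p.1 ×ˢ cuts p.2).filter fun a => a.1 ≤ a.2 ∧ (a.1 = 0 ↔ a.2 = 0)).image
        fun a => (a.1 :: p.1, a.2 :: p.2)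

theorem mem_nestedPairs {n : ℕ} {p : List ℕ × List ℕ} :
    p ∈ nestedPairs n ↔ IsNestedPair p.1 p.2 ∧ p.1.length = n := by
  induction n generalizing p with
  | zero =>
    obtain ⟨l, m⟩ := p
    cases l <;> cases m <;> simp [nestedPairs, IsNestedPair]
  | succ n ih =>
    obtain ⟨l, m⟩ := p
    simp only [nestedPairs, Finset.mem_biUnion, Finset.mem_image, Finset.mem_filter,
      Finset.mem_product, Prod.mk.injEq, ih]
    constructor
    · rintro ⟨p, ⟨h1, h2⟩, a, ⟨⟨h3, h4⟩, h5, h6⟩, rfl, rfl⟩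
      exact ⟨⟨h1, h3, h4, h5, h6⟩, by simp [h2]⟩
    · rintro ⟨h1, h2⟩
      cases l with
      | nil => simp at h2
      | cons a l =>
        cases m with
        | nil => exact h1.elim
        | cons b m =>
          obtain ⟨h1, h3, h4, h5, h6⟩ := h1
          exact ⟨(l, m), ⟨h1, by simpa using h2⟩, (a, b), ⟨⟨h3, h4⟩, h5, h6⟩, rfl, rfl⟩

/-- The intervals of `Tam v` are encoded by the pairs of nested lists over `v`. Injectivity of
`decode` comes for free from the antisymmetry of the entrywise order. -/
theorem card_nonemptyInterval_tam (v : GridPath) :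
    Nat.card (NonemptyInterval (Tam v)) =
      ((nestedPairs (v.length + 1)).filter fun p => canopy p.1 = v).card := by
  set s := (nestedPairs (v.length + 1)).filter fun p => canopy p.1 = v with hs
  have hmem : ∀ p : s, IsNestedPair p.1.1 p.1.2 ∧ p.1.1 ≠ [] ∧ p.1.2 ≠ [] ∧
      canopy p.1.1 = v ∧ canopy p.1.2 = v := by
    rintro ⟨p, hp⟩
    rw [hs, Finset.mem_filter, mem_nestedPairs] at hp
    obtain ⟨⟨h1, h2⟩, h3⟩ := hp
    refine ⟨h1, ?_, ?_, h3, (canopy_eq_of_isNestedPair h1).symm.trans h3⟩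
    · rintro h; rw [h] at h2; simp at h2
    · have := h1.length_eq
      rintro h; rw [h, h2] at this; simp at this
  have hover : ∀ l, l ≠ [] → IsNestedPair l l → canopy l = v →
      (decode l).endpoint = v.endpoint ∧ (decode l).WeaklyAbove v := by
    rintro l h0 h rfl
    exact (isOver_iff _ _).1 (isOver_decode h0 h).1
  let x : s → Tam v := fun p =>
    ⟨decode p.1.1, hover _ (hmem p).2.1 (hmem p).1.left (hmem p).2.2.2.1⟩
  let y : s → Tam v := fun p =>
    ⟨decode p.1.2, hover _ (hmem p).2.2.1 (hmem p).1.right (hmem p).2.2.2.2⟩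
  have order : ∀ l m, l ≠ [] → IsNestedPair l l → m ≠ [] → IsNestedPair m m → canopy l = v →
      canopy m = v → (Relation.ReflTransGen (Rotation v) (decode l) (decode m) ↔
        IsNestedPair l m) := by
    rintro l m hl0 hl hm0 hm rfl h
    exact reflTransGen_decode_iff hl0 hl hm0 hm h.symm
  have inj : ∀ l m, l ≠ [] → IsNestedPair l l → m ≠ [] → IsNestedPair m m → canopy l = v →
      canopy m = v → decode l = decode m → l = m := by
    intro l m hl0 hl hm0 hm h h' he
    exact ((order l m hl0 hl hm0 hm h h').1 (he ▸ .refl)).antisymm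
      ((order m l hm0 hm hl0 hl h' h).1 (he ▸ .refl))
  let Φ : s → NonemptyInterval (Tam v) := fun p =>
    ⟨(x p, y p), (Tam.le_iff _ _).2 ((order _ _ (hmem p).2.1 (hmem p).1.left (hmem p).2.2.1
      (hmem p).1.right (hmem p).2.2.2.1 (hmem p).2.2.2.2).2 (hmem p).1)⟩
  have hΦ : Function.Bijective Φ := by
    constructor
    · intro p q hpq
      have h1 : x p = x q := congrArg (fun I : NonemptyInterval (Tam v) => I.fst) hpq
      have h2 : y p = y q := congrArg (fun I : NonemptyInterval (Tam v) => I.snd) hpq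
      refine Subtype.ext (Prod.ext ?_ ?_)
      · exact inj _ _ (hmem p).2.1 (hmem p).1.left (hmem q).2.1 (hmem q).1.left
          (hmem p).2.2.2.1 (hmem q).2.2.2.1 (congrArg Subtype.val h1)
      · exact inj _ _ (hmem p).2.2.1 (hmem p).1.right (hmem q).2.2.1 (hmem q).1.right
          (hmem p).2.2.2.2 (hmem q).2.2.2.2 (congrArg Subtype.val h2)
    · rintro ⟨⟨w, w'⟩, hww'⟩
      obtain ⟨l, hl0, hl, hlv, hlw⟩ := w.isOver.exists_decode
      obtain ⟨m, hm0, hm, hmv, hmw⟩ := w'.isOver.exists_decode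
      have h := (Tam.le_iff _ _).1 hww'
      change Relation.ReflTransGen _ w.1 w'.1 at h
      rw [← hlw, ← hmw, order l m hl0 hl hm0 hm hlv hmv] at h
      have hlen : l.length = v.length + 1 := by
        rw [← hlv, length_canopy]
        have := List.length_pos_iff.2 hl0
        omega
      refine ⟨⟨(l, m), ?_⟩, ?_⟩
      · rw [hs, Finset.mem_filter, mem_nestedPairs]
        exact ⟨⟨h, hlen⟩, hlv⟩
      · exact NonemptyInterval.ext (Prod.ext (Subtype.ext hlw) (Subtype.ext hmw))
  rw [← Nat.card_congr (Equiv.ofBijective Φ hΦ)]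
  simp

theorem sum_card_nonemptyInterval_tam (n : ℕ) :
    ∑ v : List.Vector GridStep n, Nat.card (NonemptyInterval (Tam v.toList)) =
      (nestedPairs (n + 1)).card := by
  rw [Finset.card_eq_sum_card_fiberwise (f := fun p => canopy p.1)
    (t := (Finset.univ : Finset (List.Vector GridStep n)).image List.Vector.toList),
    Finset.sum_image (fun v _ w _ h => List.Vector.eq _ _ h)]
  · refine Finset.sum_congr rfl fun v _ => ?_
    rw [card_nonemptyInterval_tam, List.Vector.toList_length]
  · intro p hp
    have h := (mem_nestedPairs.1 (Finset.mem_coe.1 hp)).2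
    simp only [Finset.coe_image, Set.mem_image, Finset.mem_coe, Finset.mem_univ, true_and]
    exact ⟨⟨canopy p.1, by rw [length_canopy, h]; rfl⟩, rfl⟩

/-! ### Concatenation of nested lists -/

theorem zero_mem_cuts (l : List ℕ) : 0 ∈ cuts l := by
  cases l <;> simp [cuts]

theorem le_length_of_mem_cuts {l : List ℕ} {e : ℕ} (h : e ∈ cuts l) : e ≤ l.length := by
  induction l generalizing e with
  | nil => simpa [cuts] using h
  | cons a l ih =>
    rcases mem_cuts_cons.1 h with rfl | ⟨i, hi, -, rfl⟩
    · simp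
    · simpa using ih hi

theorem IsNestedPair.length_mem_cuts {l m : List ℕ} (h : IsNestedPair l m) :
    l.length ∈ cuts l := by
  induction l generalizing m with
  | nil => simp [cuts]
  | cons a l ih =>
    cases m with
    | nil => exact h.elim
    | cons b m =>
      exact mem_cuts_cons.2 (Or.inr ⟨_, ih h.1, le_length_of_mem_cuts h.2.1, rfl⟩)

theorem mem_cuts_append {l l' : List ℕ} (hl : IsNestedPair l l) {e : ℕ} :
    e ∈ cuts (l ++ l') ↔ e ∈ cuts l ∨ ∃ i ∈ cuts l', l.length + i = e := by
  induction l generalizing e with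
  | nil =>
    have := zero_mem_cuts l'
    simp only [cuts, List.nil_append, Finset.mem_singleton, List.length_nil, zero_add,
      exists_eq_right]
    exact ⟨Or.inr, fun h => h.elim (fun h => h ▸ this) id⟩
  | cons a l ih =>
    have ha := le_length_of_mem_cuts hl.2.1
    simp only [List.cons_append, mem_cuts_cons, ih hl.1, List.length_cons]
    constructor
    · rintro (rfl | ⟨i, hi | ⟨j, hj, rfl⟩, hai, rfl⟩)
      · exact Or.inl (Or.inl rfl)
      · exact Or.inl (Or.inr ⟨i, hi, hai, rfl⟩)
      · exact Or.inr ⟨j, hj, by omega⟩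
    · rintro ((rfl | ⟨i, hi, hai, rfl⟩) | ⟨j, hj, rfl⟩)
      · exact Or.inl rfl
      · exact Or.inr ⟨i, Or.inl hi, hai, rfl⟩
      · exact Or.inr ⟨_, Or.inr ⟨j, hj, rfl⟩, by omega, by omega⟩

theorem IsNestedPair.append {l m l' m' : List ℕ} (h : IsNestedPair l m)
    (h' : IsNestedPair l' m') : IsNestedPair (l ++ l') (m ++ m') := by
  induction l generalizing m with
  | nil => cases m <;> [exact h'; exact h.elim]
  | cons a l ih =>
    cases m with
    | nil => exact h.elim
    | cons b m =>
      exact ⟨ih h.1, (mem_cuts_append h.1.left).2 (Or.inl h.2.1),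
        (mem_cuts_append h.1.right).2 (Or.inl h.2.2.1), h.2.2.2⟩

/-- Both lists of a nested pair can be split at a cut of the larger one. -/
theorem IsNestedPair.split {l m : List ℕ} (h : IsNestedPair l m) {e : ℕ} (he : e ∈ cuts m) :
    e ∈ cuts l ∧ IsNestedPair (l.take e) (m.take e) ∧ IsNestedPair (l.drop e) (m.drop e) := by
  induction l generalizing m e with
  | nil =>
    cases m with
    | nil => simpa [IsNestedPair] using he
    | cons b m => exact h.elim
  | cons a l ih =>
    cases m with
    | nil => exact h.elim
    | cons b m =>
      rcases mem_cuts_cons.1 he with rfl | ⟨i, hi, hbi, rfl⟩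
      · exact ⟨zero_mem_cuts _, trivial, by simpa using h⟩
      · obtain ⟨h1, ha, hb, hab, h0⟩ := h
        obtain ⟨h2, h3, h4⟩ := ih h1 hi
        have aux : ∀ {k : List ℕ} {c : ℕ}, IsNestedPair (k.take i) (k.take i) → i ∈ cuts k →
            c ∈ cuts k → c ≤ i → c ∈ cuts (k.take i) := by
          intro k c hk hik hc hci
          have hlen : (k.take i).length = i := by
            rw [List.length_take]
            exact min_eq_left (le_length_of_mem_cuts hik)
          rw [← List.take_append_drop i k, mem_cuts_append hk, hlen] at hc
          rcases hc with hc | ⟨j, -, hj⟩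
          · exact hc
          · obtain rfl : c = i := by omega
            simpa only [hlen] using hk.length_mem_cuts
        exact ⟨mem_cuts_cons.2 (Or.inr ⟨i, h2, hab.trans hbi, rfl⟩),
          ⟨h3, aux h3.left h2 ha (hab.trans hbi), aux h3.right hi hb hbi, hab, h0⟩, h4⟩

theorem card_cuts_cons (a : ℕ) (l : List ℕ) :
    (cuts (a :: l)).card = ((cuts l).filter fun e => a ≤ e).card + 1 := by
  rw [cuts, Finset.card_insert_of_notMem (by simp),
    Finset.card_image_of_injective _ (add_left_injective 1)]

/-- The cut `l.length` of `l` is the cut `0` of `l'`, hence the subtraction of one. -/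
theorem card_filter_cuts_append {l l' : List ℕ} (hl : IsNestedPair l l) {a : ℕ}
    (ha : a ≤ l.length) :
    ((cuts (l ++ l')).filter fun e => a ≤ e).card =
      ((cuts l).filter fun e => a ≤ e).card + ((cuts l').card - 1) := by
  have h : (cuts (l ++ l')).filter (fun e => a ≤ e) = (cuts l).filter (fun e => a ≤ e) ∪
      ((cuts l').erase 0).image fun i => l.length + i := by
    ext e
    simp only [Finset.mem_filter, Finset.mem_union, Finset.mem_image, Finset.mem_erase,
      mem_cuts_append hl]
    constructor
    · rintro ⟨h1 | ⟨i, hi, rfl⟩, h2⟩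
      · exact Or.inl ⟨h1, h2⟩
      · by_cases h0 : i = 0
        · subst h0
          exact Or.inl ⟨hl.length_mem_cuts, h2⟩
        · exact Or.inr ⟨i, ⟨h0, hi⟩, rfl⟩
    · rintro (⟨h1, h2⟩ | ⟨i, ⟨-, hi⟩, rfl⟩)
      · exact ⟨Or.inl h1, h2⟩
      · exact ⟨Or.inr ⟨i, hi, rfl⟩, by omega⟩
  rw [h, Finset.card_union_of_disjoint,
    Finset.card_image_of_injective _ (add_right_injective l.length),
    Finset.card_erase_of_mem (zero_mem_cuts l')]
  rw [Finset.disjoint_left]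
  intro e h1 h2
  have h3 := le_length_of_mem_cuts (Finset.mem_filter.1 h1).1
  obtain ⟨i, hi, rfl⟩ := Finset.mem_image.1 h2
  have := Finset.ne_of_mem_erase hi
  omega

/-! ### The functional equation -/

section

open Polynomial

theorem sub_one_mul_sum_pow_card_filter_le (s : Finset ℕ) :
    (X - 1 : ℚ[X]) * ∑ a ∈ s, X ^ (s.filter fun e => a ≤ e).card = X * (X ^ s.card - 1) := by
  induction s using Finset.induction_on_min with
  | empty => simp
  | insert a s ha ih =>
    have has : a ∉ s := fun h => lt_irrefl _ (ha a h)
    have h1 : (insert a s).filter (fun e => a ≤ e) = insert a s := by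
      refine Finset.filter_true_of_mem fun e he => ?_
      rcases Finset.mem_insert.1 he with rfl | he
      · exact le_rfl
      · exact (ha e he).le
    have h2 : ∀ b ∈ s, (insert a s).filter (fun e => b ≤ e) = s.filter fun e => b ≤ e := by
      intro b hb
      rw [Finset.filter_insert, if_neg (not_le.2 (ha b hb))]
    rw [Finset.sum_insert has, h1, Finset.sum_congr rfl fun b hb => by rw [h2 b hb], mul_add, ih,
      Finset.card_insert_of_notMem has]
    ring

/-- The generating polynomial of the nested pairs of length `n` by the number of positive cuts of
the smaller list, the catalytic parameter. -/
noncomputable def nestedPoly (n : ℕ) : ℚ[X] :=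
  ∑ p ∈ nestedPairs n, X ^ ((cuts p.1).card - 1)

/-- The sum over the nested pairs of length `i` and the possible first entries `a` of a list whose
first block has length `i + 1`. -/
noncomputable def cutPoly (i : ℕ) : ℚ[X] :=
  ∑ p ∈ nestedPairs i, ∑ a ∈ (cuts p.1).filter fun a => a = 0 ↔ i = 0,
    X ^ ((cuts p.1).filter fun e => a ≤ e).card

theorem nestedPoly_zero : nestedPoly 0 = 1 := by
  simp [nestedPoly, nestedPairs, cuts]

theorem eval_one_nestedPoly (n : ℕ) : (nestedPoly n).eval 1 = (nestedPairs n).card := by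
  simp [nestedPoly, eval_finsetSum]

/-- The first entry `a` of the smaller list is free among the positive cuts, and the exponents run
through `1, …, k` when there are `k` of them: the sum is a geometric series. -/
theorem sub_one_mul_cutPoly (i : ℕ) :
    (X - 1) * cutPoly i =
      X * ((if i = 0 then X - 1 else 0) + (nestedPoly i - C ((nestedPoly i).eval 1))) := by
  rcases eq_or_ne i 0 with rfl | hi
  · rw [nestedPoly_zero]
    simp [cutPoly, nestedPairs, cuts, Finset.filter_singleton]
    ring
  · have h1 : ∀ p : List ℕ × List ℕ, (X - 1 : ℚ[X]) *
        ∑ a ∈ (cuts p.1).filter (fun a => a = 0 ↔ i = 0),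
          X ^ ((cuts p.1).filter fun e => a ≤ e).card = X * (X ^ ((cuts p.1).card - 1) - 1) := by
      intro p
      have h2 : (cuts p.1).filter (fun a => a = 0 ↔ i = 0) = (cuts p.1).erase 0 := by
        ext a
        simp [hi, and_comm]
      have h3 : ∀ a ∈ (cuts p.1).erase 0,
          (cuts p.1).filter (fun e => a ≤ e) = ((cuts p.1).erase 0).filter fun e => a ≤ e := by
        intro a ha
        have := Finset.ne_of_mem_erase ha
        ext e
        simp only [Finset.mem_filter, Finset.mem_erase]
        exact ⟨fun h => ⟨⟨by omega, h.1⟩, h.2⟩, fun h => ⟨h.1.2, h.2⟩⟩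
      rw [h2, Finset.sum_congr rfl fun a ha => by rw [h3 a ha],
        sub_one_mul_sum_pow_card_filter_le, Finset.card_erase_of_mem (zero_mem_cuts _)]
    rw [if_neg hi, zero_add, cutPoly, eval_one_nestedPoly, nestedPoly, Finset.mul_sum,
      Finset.sum_congr rfl fun p _ => h1 p, ← Finset.mul_sum, Finset.sum_sub_distrib]
    simp

/-- Splitting the lists after the first block of the larger one, and recording the first entry of
the smaller one. -/
theorem nestedPoly_succ (m : ℕ) : nestedPoly (m + 1) =
    ∑ x ∈ Finset.HasAntidiagonal.antidiagonal m, cutPoly x.1 * nestedPoly x.2 := by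
  let G : List ℕ × List ℕ → ℕ → ℚ[X] := fun p b =>
    ∑ a ∈ (cuts p.1).filter fun a => a ≤ b ∧ (a = 0 ↔ b = 0),
      X ^ ((cuts p.1).filter fun e => a ≤ e).card
  -- Here `p` is the pair of tails, `b` the first entry of the larger list and `a` that of the
  -- smaller one; the weight counts the cuts of the smaller list, `0` excluded.
  have h1 : nestedPoly (m + 1) = ∑ p ∈ nestedPairs m, ∑ b ∈ cuts p.2, G p b := by
    simp only [G]
    rw [Finset.sum_sigma', Finset.sum_sigma', nestedPoly]
    refine Finset.sum_nbij'
      (fun p => ⟨⟨(p.1.tail, p.2.tail), p.2.headD 0⟩, p.1.headD 0⟩)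
      (fun y => (y.2 :: y.1.1.1, y.1.2 :: y.1.1.2)) ?_ ?_ ?_ ?_ ?_
    · rintro ⟨_ | ⟨a, l⟩, _ | ⟨b, l'⟩⟩ h <;> simp only [mem_nestedPairs, IsNestedPair,
        List.length_cons, List.length_nil, false_and] at h
      · omega
      · simp only [Finset.mem_sigma, Finset.mem_filter, mem_nestedPairs, List.tail_cons,
          List.headD_cons]
        obtain ⟨⟨h1, h2, h3, h4⟩, h5⟩ := h
        exact ⟨⟨⟨h1, by omega⟩, h3⟩, h2, h4⟩
    · rintro ⟨⟨p, b⟩, a⟩ h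
      simp only [Finset.mem_sigma, Finset.mem_filter, mem_nestedPairs] at h
      obtain ⟨⟨⟨h1, h2⟩, h3⟩, h4, h5⟩ := h
      exact mem_nestedPairs.2 ⟨⟨h1, h4, h3, h5⟩, by simp [h2]⟩
    · rintro ⟨_ | ⟨a, l⟩, _ | ⟨b, l'⟩⟩ h <;> simp [mem_nestedPairs, IsNestedPair] at h ⊢
    · rintro ⟨⟨p, b⟩, a⟩ _
      simp
    · rintro ⟨_ | ⟨a, l⟩, _ | ⟨b, l'⟩⟩ h <;> simp only [mem_nestedPairs, IsNestedPair,
        List.length_cons, List.length_nil, false_and] at h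
      · omega
      · simp [card_cuts_cons]
  have h2 : ∀ x ∈ Finset.HasAntidiagonal.antidiagonal m, cutPoly x.1 * nestedPoly x.2 =
      ∑ q ∈ nestedPairs x.1 ×ˢ nestedPairs x.2, G (q.1.1 ++ q.2.1, q.1.2 ++ q.2.2) x.1 := by
    intro x _
    rw [cutPoly, nestedPoly, Finset.sum_mul_sum, Finset.sum_product]
    refine Finset.sum_congr rfl fun p hp => Finset.sum_congr rfl fun q _ => ?_
    obtain ⟨hp, hlen⟩ := mem_nestedPairs.1 hp
    have hs : (cuts (p.1 ++ q.1)).filter (fun a => a ≤ x.1 ∧ (a = 0 ↔ x.1 = 0)) =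
        (cuts p.1).filter fun a => a = 0 ↔ x.1 = 0 := by
      ext a
      simp only [Finset.mem_filter, mem_cuts_append hp.left, hlen]
      constructor
      · rintro ⟨h | ⟨i, -, rfl⟩, h2, h3⟩
        · exact ⟨h, h3⟩
        · refine ⟨?_, h3⟩
          obtain rfl : i = 0 := by omega
          rw [add_zero, ← hlen]
          exact hp.length_mem_cuts
      · rintro ⟨h, h3⟩
        exact ⟨Or.inl h, hlen ▸ le_length_of_mem_cuts h, h3⟩
    simp only [G, hs, Finset.sum_mul]
    refine Finset.sum_congr rfl fun a ha => ?_
    rw [card_filter_cuts_append hp.left (le_length_of_mem_cuts (Finset.mem_filter.1 ha).1),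
      pow_add]
  clear_value G
  rw [h1, Finset.sum_congr rfl h2, Finset.sum_sigma', Finset.sum_sigma']
  refine Finset.sum_nbij'
    (fun y => ⟨(y.2, m - y.2), ((y.1.1.take y.2, y.1.2.take y.2),
      (y.1.1.drop y.2, y.1.2.drop y.2))⟩)
    (fun y => ⟨(y.2.1.1 ++ y.2.2.1, y.2.1.2 ++ y.2.2.2), y.1.1⟩) ?_ ?_ ?_ ?_ ?_
  · rintro ⟨p, b⟩ h
    simp only [Finset.mem_sigma, mem_nestedPairs, Finset.mem_product,
      Finset.HasAntidiagonal.mem_antidiagonal] at h ⊢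
    obtain ⟨⟨h3, h4⟩, h5⟩ := h
    obtain ⟨h6, h7, h8⟩ := h3.split h5
    have h9 := le_length_of_mem_cuts h6
    refine ⟨by omega, ⟨h7, ?_⟩, h8, ?_⟩
    · rw [List.length_take]; omega
    · rw [List.length_drop]; omega
  · rintro ⟨x, q, q'⟩ h
    simp only [Finset.mem_sigma, mem_nestedPairs, Finset.mem_product,
      Finset.HasAntidiagonal.mem_antidiagonal] at h ⊢
    obtain ⟨h3, ⟨h4, h5⟩, h6, h7⟩ := h
    refine ⟨⟨h4.append h6, by rw [List.length_append]; omega⟩, ?_⟩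
    rw [mem_cuts_append h4.right, ← h5, h4.length_eq]
    exact Or.inl h4.right.length_mem_cuts
  · rintro ⟨p, b⟩ _
    simp
  · rintro ⟨⟨i, j⟩, ⟨l, l'⟩, q'⟩ h
    simp only [Finset.mem_sigma, mem_nestedPairs, Finset.mem_product,
      Finset.HasAntidiagonal.mem_antidiagonal] at h
    obtain ⟨h3, ⟨h4, h5⟩, -⟩ := h
    have h6 := h4.length_eq
    obtain rfl : j = m - i := by omega
    subst h5
    simp only [List.take_left, List.drop_left]
    rw [h6, List.take_left, List.drop_left]
  · rintro ⟨p, b⟩ _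
    simp

theorem sub_one_mul_nestedPoly_succ (m : ℕ) :
    (X - 1) * nestedPoly (m + 1) = X * ((X - 1) * nestedPoly m +
      ∑ p ∈ Finset.HasAntidiagonal.antidiagonal m,
        (nestedPoly p.1 - C ((nestedPoly p.1).eval 1)) * nestedPoly p.2) := by
  have h : ∑ p ∈ Finset.HasAntidiagonal.antidiagonal m,
      (if p.1 = 0 then (X - 1 : ℚ[X]) else 0) * nestedPoly p.2 = (X - 1) * nestedPoly m := by
    rw [Finset.sum_eq_single (0, m)]
    · simp
    · rintro ⟨i, j⟩ h1 h2
      rw [Finset.HasAntidiagonal.mem_antidiagonal] at h1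
      rw [if_neg, zero_mul]
      rintro rfl
      simp at h1
      simp [h1] at h2
    · simp
  rw [nestedPoly_succ, Finset.mul_sum, ← h, ← Finset.sum_add_distrib, Finset.mul_sum]
  refine Finset.sum_congr rfl fun p _ => ?_
  rw [← mul_assoc, sub_one_mul_cutPoly]
  ring

/-! ### Solution of the functional equation -/

/-- In `R⟦X⟧`, the equation `m = c + X * P(m)` has a solution for every polynomial `P` with
coefficients in `R⟦X⟧`. -/
theorem PowerSeries.exists_eq_add_X_mul_eval {R : Type*} [CommRing R] (c : PowerSeries R)
    (P : Polynomial (PowerSeries R)) :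
    ∃ m : PowerSeries R, m = c + PowerSeries.X * P.eval m := by
  -- The fixed point iteration starting at `0` converges `X`-adically.
  let it : ℕ → PowerSeries R := fun k => (fun m => c + PowerSeries.X * P.eval m)^[k] 0
  have it_succ : ∀ k, it (k + 1) = c + PowerSeries.X * P.eval (it k) := fun k => by
    simp only [it, Function.iterate_succ_apply']
  have hstep : ∀ k, (PowerSeries.X : PowerSeries R) ^ k ∣ it (k + 1) - it k := by
    intro k
    induction k with
    | zero => simp
    | succ k ih =>
      rw [it_succ (k + 1), it_succ k, add_sub_add_left_eq_sub, ← mul_sub, pow_succ']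
      refine mul_dvd_mul_left _ (ih.trans ?_)
      rw [← it_succ k]
      exact Polynomial.sub_dvd_eval_sub _ _ _
  have hcauchy : ∀ k j, (PowerSeries.X : PowerSeries R) ^ k ∣ it (k + j) - it k := by
    intro k j
    induction j with
    | zero => simp
    | succ j ih =>
      have := dvd_add ((pow_dvd_pow _ (Nat.le_add_right k j)).trans (hstep (k + j))) ih
      simpa [add_assoc] using this
  let m : PowerSeries R := PowerSeries.mk fun k => PowerSeries.coeff k (it (k + 1))
  have hm : ∀ k, (PowerSeries.X : PowerSeries R) ^ k ∣ m - it k := by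
    intro k
    rw [PowerSeries.X_pow_dvd_iff]
    intro i hi
    obtain ⟨j, rfl⟩ := Nat.exists_eq_add_of_le (Nat.succ_le_of_lt hi)
    have := PowerSeries.X_pow_dvd_iff.1 (hcauchy (i + 1) j) i (by omega)
    simp only [map_sub, m, PowerSeries.coeff_mk, sub_eq_zero] at this ⊢
    exact this.symm
  refine ⟨m, ?_⟩
  rw [← sub_eq_zero]
  ext k
  have h1 : (PowerSeries.X : PowerSeries R) ^ (k + 1) ∣ m - (c + PowerSeries.X * P.eval m) := by
    have h2 := hm (k + 1)
    have h3 : (PowerSeries.X : PowerSeries R) ^ (k + 1) ∣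
        PowerSeries.X * P.eval (it k) - PowerSeries.X * P.eval m := by
      rw [← mul_sub, pow_succ']
      refine mul_dvd_mul_left _ (Dvd.dvd.trans ?_ (Polynomial.sub_dvd_eval_sub _ _ _))
      rw [← neg_sub, dvd_neg]
      exact hm k
    have h4 := dvd_add h2 h3
    rw [it_succ k] at h4
    convert h4 using 1
    ring
  simpa using PowerSeries.X_pow_dvd_iff.1 h1 k (by omega)

/-- Coefficients of `u - u ^ 2`, where `u = X * (1 + u) ^ 3`. -/
theorem coeff_sub_sq_of_eq_X_mul_one_add_pow_three {u : PowerSeries ℚ}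
    (hu : u = PowerSeries.X * (1 + u) ^ 3) (n : ℕ) :
    PowerSeries.coeff (n + 1) (u - u ^ 2) =
      (2 * (3 * n + 3).factorial : ℚ) / ((n + 2).factorial * (2 * n + 3).factorial) := by
  set t : PowerSeries ℚ := PowerSeries.X with ht
  set D := PowerSeries.derivative ℚ with hD
  have h0 : PowerSeries.constantCoeff u = 0 := by rw [hu]; simp [ht]
  have hDt : D t = 1 := by simp [hD, ht]
  have h1 : D u * (1 - 2 * u) = (1 + u) ^ 4 := by
    have := congrArg D hu
    simp only [Derivation.leibniz, Derivation.leibniz_pow, map_add, Derivation.map_one_eq_zero,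
      smul_eq_mul, hDt, zero_add, nsmul_eq_mul] at this
    push_cast at this
    linear_combination (1 + u) * this - 3 * (D u) * hu
  set G := u - u ^ 2 with hG
  have h2 : D G = (1 + u) ^ 4 := by
    rw [← h1]
    simp only [hG, Derivation.leibniz_pow, map_sub, smul_eq_mul, nsmul_eq_mul]
    push_cast
    ring
  have h3 : D (D G) = 4 * (1 + u) ^ 3 * D u := by
    rw [h2]
    simp only [Derivation.leibniz_pow, map_add, Derivation.map_one_eq_zero, smul_eq_mul,
      nsmul_eq_mul]
    push_cast
    ring
  have hne : (1 - 2 * u : PowerSeries ℚ) ≠ 0 := by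
    intro h
    have := congrArg PowerSeries.constantCoeff h
    simp [h0] at this
  -- The differential equation expresses the hypergeometric recurrence of the coefficients.
  have hode : (4 : ℚ) • (t * D (t * D G)) + (6 : ℚ) • (t * D G) + (2 : ℚ) • G =
      t * ((27 : ℚ) • (t * D (t * D G)) + (27 : ℚ) • (t * D G) + (6 : ℚ) • G) + (12 : ℚ) • t := by
    apply mul_left_cancel₀ hne
    have h4 : (1 - 2 * u) * (t * D (t * D G)) =
        4 * u ^ 2 * (1 + u) + (1 - 2 * u) * (u * (1 + u)) := by
      rw [Derivation.leibniz, h3, h2, hDt]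
      simp only [smul_eq_mul]
      linear_combination 4 * (1 + u) ^ 3 * t ^ 2 * h1 - 4 * (1 + u) * (u + t * (1 + u) ^ 3) * hu
        - (1 - 2 * u) * (1 + u) * hu
    have h5 : t * D G = u * (1 + u) := by
      rw [h2]
      linear_combination -(1 + u) * hu
    rw [h5] at h4 ⊢
    simp only [Algebra.smul_def, map_ofNat]
    linear_combination (4 - 27 * t) * h4 + 12 * hu + (1 - 2 * u) * (2 - 6 * t) * hG
  have hθ : ∀ (k : ℕ) (W : PowerSeries ℚ),
      PowerSeries.coeff k (t * D W) = PowerSeries.coeff k W * k := by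
    rintro (_ | k) W
    · simp [ht]
    · rw [ht, PowerSeries.coeff_succ_X_mul, hD, PowerSeries.coeff_derivative]
      push_cast
      rfl
  have hrec : ∀ k : ℕ, (4 * (k + 1) ^ 2 + 6 * (k + 1) + 2) * PowerSeries.coeff (k + 1) G =
      (27 * k ^ 2 + 27 * k + 6) * PowerSeries.coeff k G + if k = 0 then 12 else 0 := by
    intro k
    have := congrArg (PowerSeries.coeff (k + 1)) hode
    rw [map_add _ (t * _), ht, PowerSeries.coeff_succ_X_mul, ← ht] at this
    simp only [map_add, map_smul, hθ, smul_eq_mul] at this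
    rw [ht, PowerSeries.coeff_X] at this
    simp only [add_eq_right, mul_ite, mul_one, mul_zero] at this
    push_cast at this
    linear_combination this
  induction n with
  | zero =>
    have := hrec 0
    have hG0 : PowerSeries.coeff 0 G = 0 := by simp [hG, h0]
    rw [hG0] at this
    norm_num at this
    norm_num [Nat.factorial]
    linarith
  | succ n ih =>
    have := hrec (n + 1)
    rw [ih] at this
    have e1 : ((n + 1 + 2).factorial : ℚ) = (n + 3) * (n + 2).factorial := by
      rw [show n + 1 + 2 = (n + 2) + 1 by ring, Nat.factorial_succ]; push_cast; ring
    have e2 : ((2 * (n + 1) + 3).factorial : ℚ) =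
        (2 * n + 5) * ((2 * n + 4) * (2 * n + 3).factorial) := by
      rw [show 2 * (n + 1) + 3 = (2 * n + 3) + 1 + 1 by ring, Nat.factorial_succ,
        Nat.factorial_succ]
      push_cast; ring
    have e3 : ((3 * (n + 1) + 3).factorial : ℚ) =
        (3 * n + 6) * ((3 * n + 5) * ((3 * n + 4) * (3 * n + 3).factorial)) := by
      rw [show 3 * (n + 1) + 3 = (3 * n + 3) + 1 + 1 + 1 by ring, Nat.factorial_succ,
        Nat.factorial_succ, Nat.factorial_succ]
      push_cast; ring
    have f1 : ((n + 2).factorial : ℚ) ≠ 0 := by positivity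
    have f2 : ((2 * n + 3).factorial : ℚ) ≠ 0 := by positivity
    rw [e1, e2, e3]
    simp only [Nat.succ_ne_zero, if_false, add_zero] at this
    push_cast at this
    rw [eq_div_iff (by positivity)]
    rw [mul_div_assoc', eq_div_iff (by positivity)] at this
    linear_combination (n + 2 : ℚ) * this

/-- The functional equation `F = 1 + x t F (1 + (F - F(1)) / (x - 1))` in one catalytic variable,
stated for the coefficients `f m` of `t ^ m` in `F`, determines the numbers `f m (1)`. -/
theorem eval_one_of_catalytic_recurrence {f : ℕ → ℚ[X]} (hf0 : f 0 = 1)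
    (hf : ∀ m, (X - 1) * f (m + 1) = X * ((X - 1) * f m +
      ∑ p ∈ Finset.HasAntidiagonal.antidiagonal m, (f p.1 - C ((f p.1).eval 1)) * f p.2)) (n : ℕ) :
    (f (n + 1)).eval 1 =
      (2 * (3 * n + 3).factorial : ℚ) / ((n + 2).factorial * (2 * n + 3).factorial) := by
  obtain ⟨u, hu⟩ : ∃ u : PowerSeries ℚ, u = PowerSeries.X * (1 + u) ^ 3 := by
    obtain ⟨u, hu⟩ := PowerSeries.exists_eq_add_X_mul_eval (0 : PowerSeries ℚ) ((1 + X) ^ 3)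
    exact ⟨u, by simpa using hu⟩
  have hu0 : PowerSeries.constantCoeff u = 0 := by rw [hu]; simp
  let ι : PowerSeries ℚ →+* PowerSeries ℚ[X] := PowerSeries.map (C : ℚ →+* ℚ[X])
  let ε : PowerSeries ℚ[X] →+* PowerSeries ℚ := PowerSeries.map (evalRingHom 1)
  have hει : ∀ w, ε (ι w) = w := fun w => by ext k; simp [ε, ι]
  let x : PowerSeries ℚ[X] := PowerSeries.C X
  have hεx : ε x = 1 := by simp [ε, x]
  have hεt : ε PowerSeries.X = PowerSeries.X := by simp [ε]
  have hιt : ι PowerSeries.X = PowerSeries.X := by simp [ι]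
  obtain ⟨M, hM⟩ : ∃ M : PowerSeries ℚ[X],
      M = ι u + PowerSeries.X * (x * M * (1 + ι u + M)) := by
    obtain ⟨M, hM⟩ := PowerSeries.exists_eq_add_X_mul_eval (ι u) (C x * X * (1 + C (ι u) + X))
    exact ⟨M, by simpa using hM⟩
  have hv : (1 + ι u) * ι (1 + u)⁻¹ = 1 := by
    rw [← map_one ι, ← map_add, ← map_mul, PowerSeries.mul_inv_cancel _ (by simp [hu0])]
  have hU : ι u = PowerSeries.X * (1 + ι u) ^ 3 := by
    conv_lhs => rw [hu]
    simp [hιt]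
  set U := ι u
  set V := ι (1 + u)⁻¹
  set t : PowerSeries ℚ[X] := PowerSeries.X with ht
  -- `V` is the inverse of `1 + U`. Multiplying by a power of `1 + U` and eliminating `t` turns the
  -- functional equation for `F` into a multiple of the equation of `M`; the square in the cofactor
  -- is the double root `x = 1 + U` of the discriminant.
  obtain ⟨F, hF⟩ : ∃ F, F = 1 + U - M + x * M * V := ⟨_, rfl⟩
  have hFeq : (x - 1) * F = (x - 1) + x * t * F * (x - 1 + F - (1 + U - U ^ 2)) := by
    have hW : (1 + U) ≠ 0 := fun h => by simp [h] at hv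
    have h1 : (1 + U) * F = (1 + U) * (1 + U - M) + x * M := by
      rw [hF]; linear_combination x * M * hv
    have h2 : x * M * (1 + U + M) * U = (1 + U) ^ 3 * (M - U) := by
      linear_combination x * M * (1 + U + M) * hU - (1 + U) ^ 3 * hM
    apply mul_left_cancel₀ (pow_ne_zero 5 hW)
    calc (1 + U) ^ 5 * ((x - 1) * F) = (1 + U) ^ 4 * (x - 1) * ((1 + U) * F) := by ring
      _ = (1 + U) ^ 5 * (x - 1) + x * U * ((1 + U) * F) *
          ((1 + U) * (x - 1 - (1 + U - U ^ 2)) + (1 + U) * F) := by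
        rw [h1]
        linear_combination -(x - (1 + U)) ^ 2 * h2
      _ = _ := by
        linear_combination x * ((1 + U) * F) *
          ((1 + U) * (x - 1 - (1 + U - U ^ 2)) + (1 + U) * F) * hU
  have hcoeff0 : PowerSeries.coeff 0 F = 1 := by
    have := congrArg (PowerSeries.coeff 0) hFeq
    have hx : (X - 1 : ℚ[X]) ≠ 0 := by
      simpa using X_sub_C_ne_zero (1 : ℚ)
    apply mul_left_cancel₀ hx
    simpa [x, ht] using this
  -- At `x = 1` the equation reads `0 = t F(1) (F(1) - (1 + u - u ^ 2))`.
  have hεF : ε F = 1 + u - u ^ 2 := by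
    have h1 := congrArg ε hFeq
    simp only [map_mul, map_sub, map_add, map_pow, map_one, hεx, hει, U, ht] at h1
    have h2 : ε F ≠ 0 := by
      intro h
      have := congrArg (PowerSeries.coeff 0) h
      simp only [ε, PowerSeries.coeff_map, hcoeff0] at this
      simp at this
    have h3 : PowerSeries.X * ε F * (ε F - (1 + u - u ^ 2)) = 0 := by
      rw [← hεt]
      linear_combination -h1
    simpa [h2, PowerSeries.X_ne_zero, sub_eq_zero] using h3
  -- The recurrence determines the coefficients, so `F` is the given generating function.
  have hFf : ∀ m, PowerSeries.coeff m F = f m := by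
    intro m
    induction m using Nat.strong_induction_on with
    | _ m ih =>
      cases m with
      | zero => rw [hcoeff0, hf0]
      | succ m =>
        have hx : (X - 1 : ℚ[X]) ≠ 0 := by
          simpa using X_sub_C_ne_zero (1 : ℚ)
        apply mul_left_cancel₀ hx
        have h1 : PowerSeries.C (X - 1) * F = PowerSeries.C (X - 1) + PowerSeries.X *
            (PowerSeries.C X * (PowerSeries.C (X - 1) * F + (F - ι (ε F)) * F)) := by
          have h3 : PowerSeries.C (X - 1 : ℚ[X]) = x - 1 := by simp [x]
          rw [h3, hεF]
          simp only [map_sub, map_add, map_one, map_pow]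
          linear_combination hFeq
        have h2 := congrArg (PowerSeries.coeff (m + 1)) h1
        rw [map_add (PowerSeries.coeff (m + 1)), PowerSeries.coeff_succ_X_mul,
          PowerSeries.coeff_C_mul, PowerSeries.coeff_C_mul, map_add (PowerSeries.coeff m),
          PowerSeries.coeff_C_mul, PowerSeries.coeff_mul, PowerSeries.coeff_C,
          if_neg (Nat.succ_ne_zero m), zero_add] at h2
        simp only [map_sub, ι, ε, PowerSeries.coeff_map] at h2
        rw [h2, hf, ih m (by omega)]
        congr 2
        refine Finset.sum_congr rfl fun p hp => ?_
        rw [Finset.HasAntidiagonal.mem_antidiagonal] at hp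
        rw [ih p.1 (by omega), ih p.2 (by omega)]
        rfl
  rw [← coeff_sub_sq_of_eq_X_mul_one_add_pow_three hu, ← hFf]
  have := congrArg (PowerSeries.coeff (n + 1)) hεF
  simp only [ε, PowerSeries.coeff_map] at this
  rw [coe_evalRingHom] at this
  rw [this, add_sub_assoc, map_add, PowerSeries.coeff_one]
  simp

end

theorem mainTheorem1 (n : ℕ) :
    ((∑ v : List.Vector GridStep n, Nat.card (NonemptyInterval (Tam v.toList)) : ℕ) : ℚ) =
      (2 * (3 * n + 3).factorial : ℚ) / ((n + 2).factorial * (2 * n + 3).factorial) := by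
  rw [sum_card_nonemptyInterval_tam, ← eval_one_nestedPoly]
  exact eval_one_of_catalytic_recurrence nestedPoly_zero sub_one_mul_nestedPoly_succ n
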